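/- Let $A$ be a finite set and let $f\colon A^3\to A$ be a conservative minority operation, i.e. $f(x,y,z)\in\{x,y,z\}$ and $f(x,x,y)=f(x,y,x)=f(y,x,x)=y$ for all $x,y,z\in A$. Put $\mathbf A=(A;f)$. An algebra is called subdirectly irreducible if it has exactly one atomic congruence (a congruence different from equality that is minimal with this property); this congruence is then called its monolith. For every subdirectly irreducible subalgebra $\mathbf C\le\mathbf A$ whose monolith has a nontrivial class with exactly two elements, fix an arbitrary labeling of the two elements of this class by $0$ and $1$. Consider the set $\mathcal R$ of the following relations on $A$: (a) all unary relations $X\subseteq A$; (b) for all subalgebras $\mathbf C\le\mathbf B\le\mathbf A$ with $\mathbf C$ subdirectly irreducible, all subdirect transversal endomorphism graphs $S\le\mathbf B\times\mathbf C$, i.e. all graphs $S=\{(b,h(b)) : b\in B\}$ of surjective homomorphisms $h\colon\mathbf B\to\mathbf C$ with $S\subseteq\ker h$, that is, $h(h(b))=h(b)$ for all $b\in B$; (c) all graphs of isomorphisms $\mathbf A_1\to\mathbf A_2$ between subdirectly irreducible subalgebras $\mathbf A_1,\mathbf A_2\le\mathbf A$; (d) for each subdirectly irreducible $\mathbf C\le\mathbf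 A$ whose monolith has a nontrivial class with exactly two elements, labeled $0$ and $1$ as above, the ternary relation $$\mathrm{Lin}_{\mathbf C}=\{(x,y,z)\in\{0,1\}^3 : x+y+z=1 \text{ in } \mathbb Z_2\}\cup\{(c,c,c) : c\in C\setminus\{0,1\}\}.$$ Then $\mathcal R$ is a finite set of relations of arity at most three, and for every $k\in\mathbb N$ and every $R\subseteq A^k$ the following are equivalent: 1. $R$ is preserved by $f$, i.e. $R$ is closed under the componentwise application of $f$; 2. $R$ is primitively positively definable from $\mathcal R$, i.e. $R$ is defined by a formula $\exists y_1,\dots,y_n\,(\psi_1\wedge\dots\wedge\psi_m)$ with $n,m\ge 0$ in which every $\psi_j$ is an equality between variables or a relation of $\mathcal R$ applied to variables. -/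

import Mathlib

namespace ConsMinority

universe u

/-! ### Algebras with one ternary operation -/

/-- `f` always returns one of its arguments. -/
def IsConservative {A : Type u} (f : A → A → A → A) : Prop :=
  ∀ x y z, f x y z = x ∨ f x y z = y ∨ f x y z = z

def IsMinority {A : Type u} (f : A → A → A → A) : Prop :=
  ∀ x y, f x x y = y ∧ f x y x = y ∧ f y x x = y

/-- Subalgebras of `(A; f)`. -/
structure Subalg {A : Type u} (f : A → A → A → A) where
  carrier : Set A
  closed : ∀ x ∈ carrier, ∀ y ∈ carrier, ∀ z ∈ carrier, f x y z ∈ carrier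

/-- The operation of a subalgebra, on the subtype of its elements. -/
def Subalg.op {A : Type u} {f : A → A → A → A} (B : Subalg f) :
    B.carrier → B.carrier → B.carrier → B.carrier :=
  fun x y z => ⟨f x y z, B.closed x x.2 y y.2 z z.2⟩

def IsHom {X Y : Type u} (g : X → X → X → X) (g' : Y → Y → Y → Y) (h : X → Y) : Prop :=
  ∀ x y z, h (g x y z) = g' (h x) (h y) (h z)

def IsCongruence {X : Type u} (g : X → X → X → X) (θ : Setoid X) : Prop :=
  ∀ x x' y y' z z', θ x x' → θ y y' → θ z z' → θ (g x y z) (g x' y' z')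

/-- A congruence different from equality (`⊥`) that is minimal with this property. -/
def IsAtomicCongruence {X : Type u} (g : X → X → X → X) (θ : Setoid X) : Prop :=
  IsCongruence g θ ∧ θ ≠ ⊥ ∧ ∀ θ' : Setoid X, IsCongruence g θ' → θ' ≠ ⊥ → θ' ≤ θ → θ' = θ

/-- `μ` is the monolith: the only atomic congruence. -/
def IsMonolith {X : Type u} (g : X → X → X → X) (μ : Setoid X) : Prop :=
  IsAtomicCongruence g μ ∧ ∀ θ : Setoid X, IsAtomicCongruence g θ → θ = μ

/-- There is exactly one atomic congruence. -/
def IsSubdirectlyIrreducible {X : Type u} (g : X → X → X → X) : Prop :=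
  ∃! θ : Setoid X, IsAtomicCongruence g θ

/-! ### Relations and primitive positive definability -/

/-- Relations of finite arity on `A`, together with their arity. -/
structure FinRel (A : Type u) where
  arity : ℕ
  tuples : Set (Fin arity → A)

/-- A binary relation given as a set of pairs, as a relation of arity two. -/
def FinRel.ofPairs {A : Type u} (S : Set (A × A)) : FinRel A :=
  ⟨2, {t | (t 0, t 1) ∈ S}⟩

def Preserves {A : Type u} (f : A → A → A → A) {k : ℕ} (R : Set (Fin k → A)) : Prop :=
  ∀ r ∈ R, ∀ s ∈ R, ∀ t ∈ R, (fun i => f (r i) (s i) (t i)) ∈ R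

/-- Atomic formulas with variables in `V` and a relation symbol for each member of `Γ`. -/
inductive Atom {A : Type u} (Γ : Set (FinRel A)) (V : Type) : Type u
  | eq (x y : V) : Atom Γ V
  | rel (R : FinRel A) (hR : R ∈ Γ) (x : Fin R.arity → V) : Atom Γ V

/-- The atomic formula holds under the assignment `v`. -/
def Atom.Holds {A : Type u} {Γ : Set (FinRel A)} {V : Type} (v : V → A) : Atom Γ V → Prop
  | .eq x y => v x = v y
  | .rel R _ x => (fun i => v (x i)) ∈ R.tuples

/-- `R` is defined by a formula `∃ y₁ … yₙ, ψ₁ ∧ ⋯ ∧ ψₘ` with atomic `ψⱼ` over `Γ`. The free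
variables are the `Sum.inl i`, the quantified ones the `Sum.inr j`. -/
def PPDefinable {A : Type u} (Γ : Set (FinRel A)) {k : ℕ} (R : Set (Fin k → A)) : Prop :=
  ∃ (n : ℕ) (ψ : List (Atom Γ (Fin k ⊕ Fin n))),
    ∀ t : Fin k → A, t ∈ R ↔ ∃ y : Fin n → A, ∀ φ ∈ ψ, φ.Holds (Sum.elim t y)

/-! ### The four families of relations -/

def unaryRelations (A : Type u) : Set (FinRel A) :=
  {R | ∃ X : Set A, R = ⟨1, {t | t 0 ∈ X}⟩}

/-- The graph of a map between subalgebras, as a set of pairs of elements of `A`. -/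
def graphOf {A : Type u} {f : A → A → A → A} {B C : Subalg f} (h : B.carrier → C.carrier) :
    Set (A × A) :=
  {p | ∃ b : B.carrier, p = ((b : A), (h b : A))}

/-- `S ∘ S⁻¹`: for the graph `S` of a map this is the kernel of the map. -/
def kernelOf {A : Type u} (S : Set (A × A)) : Set (A × A) :=
  {p | ∃ z, (p.1, z) ∈ S ∧ (p.2, z) ∈ S}

/-- `S` is the graph of a homomorphism from `B` onto its subalgebra `C` such that `S` is contained
in the kernel of the homomorphism. -/
def IsTransversalEndoGraph {A : Type u} {f : A → A → A → A} (B C : Subalg f)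
    (S : Set (A × A)) : Prop :=
  C.carrier ⊆ B.carrier ∧
    ∃ h : B.carrier → C.carrier, IsHom B.op C.op h ∧ Function.Surjective h ∧
      S = graphOf h ∧ S ⊆ kernelOf S

/-- Both projections of `S ⊆ B × C` are full. -/
def IsSubdirect {A : Type u} {f : A → A → A → A} (B C : Subalg f) (S : Set (A × A)) : Prop :=
  Prod.fst '' S = B.carrier ∧ Prod.snd '' S = C.carrier

def transversalRelations {A : Type u} (f : A → A → A → A) : Set (FinRel A) :=
  {R | ∃ (B C : Subalg f) (S : Set (A × A)), IsSubdirectlyIrreducible C.op ∧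
    IsTransversalEndoGraph B C S ∧ IsSubdirect B C S ∧ R = FinRel.ofPairs S}

def isomorphismRelations {A : Type u} (f : A → A → A → A) : Set (FinRel A) :=
  {R | ∃ (B C : Subalg f) (h : B.carrier → C.carrier),
    IsSubdirectlyIrreducible B.op ∧ IsSubdirectlyIrreducible C.op ∧
    IsHom B.op C.op h ∧ Function.Bijective h ∧ R = FinRel.ofPairs (graphOf h)}

/-- `C` has a monolith, and `D` is a two-element class of it. -/
def IsTwoElementMonolithClass {A : Type u} {f : A → A → A → A} (C : Subalg f) (D : Set A) : Prop :=
  ∃ μ : Setoid C.carrier, IsMonolith C.op μ ∧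
    (∃ c : C.carrier, D = (fun x : C.carrier => (x : A)) '' {x | μ x c}) ∧ D.ncard = 2

/-- For every subdirectly irreducible subalgebra `C` whose monolith has a two-element nontrivial
class, `label C` labels the two elements of this class by `0` and `1` (values elsewhere are
irrelevant). -/
def IsLabeling {A : Type u} {f : A → A → A → A} (label : Subalg f → A → ZMod 2) : Prop :=
  ∀ (C : Subalg f) (D : Set A), IsSubdirectlyIrreducible C.op → IsTwoElementMonolithClass C D →
    Set.BijOn (label C) D Set.univ

/-- Triples in `D` whose labels solve `x + y + z = 1` over `ℤ/2ℤ`, and constant triples with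
value in `C \ D`. -/
def linTuples {A : Type u} {f : A → A → A → A} (C : Subalg f) (D : Set A) (ℓ : A → ZMod 2) :
    Set (Fin 3 → A) :=
  {t | (∀ i, t i ∈ D) ∧ ℓ (t 0) + ℓ (t 1) + ℓ (t 2) = 1} ∪
    {t | ∃ c ∈ C.carrier \ D, t = fun _ => c}

def linRelations {A : Type u} {f : A → A → A → A} (label : Subalg f → A → ZMod 2) :
    Set (FinRel A) :=
  {R | ∃ (C : Subalg f) (D : Set A), IsSubdirectlyIrreducible C.op ∧
    IsTwoElementMonolithClass C D ∧ R = ⟨3, linTuples C D (label C)⟩}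

/-- All the listed relations, with the chosen labels. -/
def basis {A : Type u} (f : A → A → A → A) (label : Subalg f → A → ZMod 2) : Set (FinRel A) :=
  unaryRelations A ∪ transversalRelations f ∪ isomorphismRelations f ∪ linRelations label

end ConsMinority

/-! Definable relations are closed because each basis relation is. The delicate case is `Lin`: on a
two-element monolith class `f` is `x + y + z`, and conservativity controls how the class interacts
with elements outside it (`linTuples_closed`).

Conversely, a closed `R` is the intersection of definable relations, one for each tuple `t ∉ R`,
that contain `R` and omit `t`. To find one, restrict to a minimal set of coordinates on which no
member of `R` agrees with `t`, so that changing `t` at any one of them can lead into `R`, and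
enlarge `R` to a maximal closed relation omitting `t`. Values that are interchangeable at a
coordinate are collapsed to representatives. By conservativity the representatives form a
subalgebra, so this collapse is a transversal endomorphism graph (`ppDef_of_maximal`). What remains
is a critical relation, in which every coordinate is a function of the others.

Maximality forces every nontrivial congruence of a projection to contain `(s i, t i)`, so the
projections are subdirectly irreducible (`Critical.rel_of_nontrivial`). With two coordinates the
relation is the graph of an isomorphism. With three or more, the monolith class of `t i` is exactly
`{s i, t i}` (`Critical.eq_or_eq_of_monolith`). Inside these classes the relation is a parity
condition (`Critical.piecewise_mem_iff`); outside them a tuple is determined by any one coordinate.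
Together these give isomorphisms between the projections (`Critical.isoGraph_mem`), which carry the
whole relation to one subalgebra, where a chain of `Lin` constraints expresses the parity. -/

namespace ConsMinority

universe u

/-! ### Primitive positive definability with arbitrary finite sets of variables -/

section PP

variable {A : Type u} {Γ : Set (FinRel A)} {V U W : Type}

/-- Substitution of variables in an atomic formula. -/
def Atom.map (σ : V → U) : Atom Γ V → Atom Γ U
  | .eq x y => .eq (σ x) (σ y)
  | .rel R hR x => .rel R hR (fun i => σ (x i))

theorem Atom.holds_map (σ : V → U) (φ : Atom Γ V) (v : U → A) :
    (φ.map σ).Holds v ↔ φ.Holds (fun i => v (σ i)) := by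
  cases φ <;> rfl

/-- Primitive positive definability for relations whose coordinates are indexed by `V`. -/
def PPDef (Γ : Set (FinRel A)) (R : Set (V → A)) : Prop :=
  ∃ (W : Type) (_ : Finite W) (ψ : List (Atom Γ (V ⊕ W))),
    ∀ t : V → A, t ∈ R ↔ ∃ y : W → A, ∀ φ ∈ ψ, φ.Holds (Sum.elim t y)

theorem PPDef.ppDefinable {k : ℕ} {R : Set (Fin k → A)} (h : PPDef Γ R) : PPDefinable Γ R := by
  obtain ⟨W, hW, ψ, hψ⟩ := h
  obtain ⟨n, ⟨e⟩⟩ := Finite.exists_equiv_fin W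
  refine ⟨n, ψ.map (Atom.map (Sum.map id e)), fun t => (hψ t).trans ?_⟩
  constructor
  · rintro ⟨y, hy⟩
    refine ⟨fun j => y (e.symm j), fun φ hφ => ?_⟩
    obtain ⟨φ', hφ', rfl⟩ := List.mem_map.1 hφ
    rw [Atom.holds_map]
    convert hy φ' hφ' using 1
    funext i
    rcases i with i | i <;> simp
  · rintro ⟨y, hy⟩
    refine ⟨fun j => y (e j), fun φ hφ => ?_⟩
    have := hy _ (List.mem_map_of_mem hφ)
    rw [Atom.holds_map] at this
    convert this using 1
    funext i
    rcases i with i | i <;> simp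

theorem PPDef.univ : PPDef Γ (Set.univ : Set (V → A)) :=
  ⟨Empty, inferInstance, [], fun _ => by simp⟩

theorem PPDef.rel {R : FinRel A} (hR : R ∈ Γ) (x : Fin R.arity → V) :
    PPDef Γ {t : V → A | (fun i => t (x i)) ∈ R.tuples} :=
  ⟨Empty, inferInstance, [.rel R hR fun i => .inl (x i)], fun t => by simp [Atom.Holds]⟩

theorem PPDef.inter {R S : Set (V → A)} (hR : PPDef Γ R) (hS : PPDef Γ S) :
    PPDef Γ (R ∩ S) := by
  obtain ⟨W, _, ψ, hψ⟩ := hR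
  obtain ⟨W', _, ψ', hψ'⟩ := hS
  refine ⟨W ⊕ W', inferInstance, ψ.map (Atom.map (Sum.map id .inl)) ++
    ψ'.map (Atom.map (Sum.map id .inr)), fun t => ?_⟩
  have key : ∀ y : W ⊕ W' → A,
      (∀ φ ∈ ψ.map (Atom.map (Sum.map id .inl)) ++ ψ'.map (Atom.map (Sum.map id .inr)),
        φ.Holds (Sum.elim t y)) ↔
      (∀ φ ∈ ψ, φ.Holds (Sum.elim t fun j => y (.inl j))) ∧
        ∀ φ ∈ ψ', φ.Holds (Sum.elim t fun j => y (.inr j)) := by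
    intro y
    have e₁ : (fun i => Sum.elim t y (Sum.map id Sum.inl i)) =
        Sum.elim t fun j : W => y (.inl j) := by
      funext i; rcases i with i | i <;> rfl
    have e₂ : (fun i => Sum.elim t y (Sum.map id Sum.inr i)) =
        Sum.elim t fun j : W' => y (.inr j) := by
      funext i; rcases i with i | i <;> rfl
    simp only [List.mem_append, or_imp, forall_and, List.forall_mem_map, Atom.holds_map, e₁, e₂]
  rw [Set.mem_inter_iff, hψ, hψ']
  constructor
  · rintro ⟨⟨y, hy⟩, ⟨z, hz⟩⟩
    exact ⟨Sum.elim y z, (key _).2 ⟨hy, hz⟩⟩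
  · rintro ⟨y, hy⟩
    exact ⟨⟨_, ((key y).1 hy).1⟩, ⟨_, ((key y).1 hy).2⟩⟩

theorem PPDef.comap {R : Set (V → A)} (hR : PPDef Γ R) (σ : V → U) :
    PPDef Γ {t : U → A | (fun i => t (σ i)) ∈ R} := by
  obtain ⟨W, _, ψ, hψ⟩ := hR
  refine ⟨W, inferInstance, ψ.map (Atom.map (Sum.map σ id)), fun t => ?_⟩
  have e : ∀ y : W → A, (fun i => Sum.elim t y (Sum.map σ id i)) =
      Sum.elim (fun i => t (σ i)) y := by
    intro y; funext i; rcases i with i | i <;> rfl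
  simp only [Set.mem_ofPred_eq, hψ, List.forall_mem_map, Atom.holds_map, e]

theorem PPDef.exists [Finite W] {R : Set (V ⊕ W → A)} (hR : PPDef Γ R) :
    PPDef Γ {t : V → A | ∃ y : W → A, Sum.elim t y ∈ R} := by
  obtain ⟨W', _, ψ, hψ⟩ := hR
  refine ⟨W ⊕ W', inferInstance, ψ.map (Atom.map (Equiv.sumAssoc V W W')), fun t => ?_⟩
  have e : ∀ y : W ⊕ W' → A, (fun i => Sum.elim t y (Equiv.sumAssoc V W W' i)) =
      Sum.elim (Sum.elim t fun j => y (.inl j)) fun j => y (.inr j) := by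
    intro y; funext i; rcases i with (i | i) | i <;> rfl
  simp only [Set.mem_ofPred_eq, hψ, List.forall_mem_map, Atom.holds_map, e]
  constructor
  · rintro ⟨y, z, h⟩
    exact ⟨Sum.elim y z, h⟩
  · rintro ⟨y, h⟩
    exact ⟨_, _, h⟩

theorem PPDef.forall {ι : Type*} [Finite ι] {R : ι → Set (V → A)} (hR : ∀ i, PPDef Γ (R i)) :
    PPDef Γ {t : V → A | ∀ i, t ∈ R i} := by
  classical
  have := Fintype.ofFinite ι
  have key : ∀ s : Finset ι, PPDef Γ {t : V → A | ∀ i ∈ s, t ∈ R i} := by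
    intro s
    induction s using Finset.induction_on with
    | empty => simpa using PPDef.univ
    | insert a s _ ih =>
      convert (hR a).inter ih using 1
      ext t
      simp
  simpa using key Finset.univ

theorem PPDef.pair {S : Set (A × A)} (hS : FinRel.ofPairs S ∈ Γ) (x y : V) :
    PPDef Γ {t : V → A | (t x, t y) ∈ S} :=
  PPDef.rel hS ![x, y]

theorem PPDef.mem (hΓ : unaryRelations A ⊆ Γ) (X : Set A) (x : V) :
    PPDef Γ {t : V → A | t x ∈ X} :=
  PPDef.rel (R := ⟨1, {t | t 0 ∈ X}⟩) (hΓ ⟨X, rfl⟩) fun _ => x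

theorem PPDef.empty (hΓ : unaryRelations A ⊆ Γ) : PPDef Γ (∅ : Set (V → A)) := by
  convert (PPDef.mem hΓ (∅ : Set A) (Sum.inr () : V ⊕ Unit)).exists using 1
  ext t
  simp

end PP

/-! ### Closed relations -/

section Closed

variable {A : Type u} {f : A → A → A → A} {V U : Type}

/-- `R` is closed under the componentwise application of `f`. -/
def Closed (f : A → A → A → A) (R : Set (V → A)) : Prop :=
  ∀ r ∈ R, ∀ s ∈ R, ∀ t ∈ R, (fun i => f (r i) (s i) (t i)) ∈ R

theorem preserves_of_ppDefinable {Γ : Set (FinRel A)} (hΓ : ∀ R ∈ Γ, Preserves f R.tuples)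
    {k : ℕ} {R : Set (Fin k → A)} (hR : PPDefinable Γ R) : Preserves f R := by
  obtain ⟨n, ψ, hψ⟩ := hR
  intro r hr s hs t ht
  obtain ⟨x, hx⟩ := (hψ r).1 hr
  obtain ⟨y, hy⟩ := (hψ s).1 hs
  obtain ⟨z, hz⟩ := (hψ t).1 ht
  refine (hψ _).2 ⟨fun j => f (x j) (y j) (z j), fun φ hφ => ?_⟩
  have e : Sum.elim (fun i => f (r i) (s i) (t i)) (fun j => f (x j) (y j) (z j)) =
      fun i => f (Sum.elim r x i) (Sum.elim s y i) (Sum.elim t z i) := by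
    funext i; rcases i with i | i <;> rfl
  have h₁ := hx φ hφ
  have h₂ := hy φ hφ
  have h₃ := hz φ hφ
  rw [e]
  cases φ with
  | eq a b =>
    simp only [Atom.Holds] at h₁ h₂ h₃ ⊢
    rw [h₁, h₂, h₃]
  | rel Q hQ a => exact hΓ Q hQ _ h₁ _ h₂ _ h₃

theorem Closed.restrict {R : Set (V → A)} (hR : Closed f R) (σ : U → V) :
    Closed f {x : U → A | ∃ r ∈ R, x = fun i => r (σ i)} := by
  rintro _ ⟨r, hr, rfl⟩ _ ⟨s, hs, rfl⟩ _ ⟨t, ht, rfl⟩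
  exact ⟨_, hR r hr s hs t ht, rfl⟩

end Closed

/-! ### Congruences of subalgebras, as relations on the ambient set -/

section Cong

variable {A : Type u} {f : A → A → A → A} {V : Type}

/-- `θ` is a congruence of the subalgebra with carrier `C`. -/
structure CongOn (f : A → A → A → A) (C : Set A) (θ : A → A → Prop) : Prop where
  mem : ∀ {x y}, θ x y → x ∈ C
  refl : ∀ {x}, x ∈ C → θ x x
  symm : ∀ {x y}, θ x y → θ y x
  trans : ∀ {x y z}, θ x y → θ y z → θ x z
  compat : ∀ {x u y v z w}, θ x u → θ y v → θ z w → θ (f x y z) (f u v w)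

/-- `θ` relates two different elements. -/
def IsNontrivialRel (θ : A → A → Prop) : Prop := ∃ a b, θ a b ∧ a ≠ b

theorem CongOn.mem_right {C : Set A} {θ : A → A → Prop} (h : CongOn f C θ) {x y : A}
    (hxy : θ x y) : y ∈ C :=
  h.mem (h.symm hxy)

theorem CongOn.map_left {C : Set A} {θ : A → A → Prop} (h : CongOn f C θ) (hmin : IsMinority f)
    {d d' c : A} (hd : θ d d') (hc : c ∈ C) : θ (f d d' c) c := by
  have := h.compat hd (h.refl (h.mem_right hd)) (h.refl hc)
  rwa [(hmin d' c).1] at this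

theorem CongOn.map_middle {C : Set A} {θ : A → A → Prop} (h : CongOn f C θ) (hmin : IsMinority f)
    {d d' c : A} (hd : θ d d') (hc : c ∈ C) : θ (f d c d') c := by
  have := h.compat hd (h.refl hc) (h.refl (h.mem_right hd))
  rwa [(hmin d' c).2.1] at this

theorem CongOn.map_right {C : Set A} {θ : A → A → Prop} (h : CongOn f C θ) (hmin : IsMinority f)
    {d d' c : A} (hd : θ d d') (hc : c ∈ C) : θ (f c d d') c := by
  have := h.compat (h.refl hc) hd (h.refl (h.mem_right hd))
  rwa [(hmin d' c).2.2] at this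

/-- If two of the arguments are related and the third one is not related to them, the result is
the third one. -/
theorem CongOn.eq_of_not_rel {C : Set A} {θ : A → A → Prop} (h : CongOn f C θ)
    (hcons : IsConservative f) (hmin : IsMinority f) {d d' c : A} (hd : θ d d') (hc : c ∈ C)
    (hn : ¬ θ d c) : f d d' c = c ∧ f d c d' = c ∧ f c d d' = c := by
  have h₁ := h.map_left hmin hd hc
  have h₂ := h.map_middle hmin hd hc
  have h₃ := h.map_right hmin hd hc
  have hn' : ¬ θ d' c := fun h' => hn (h.trans hd h')
  refine ⟨?_, ?_, ?_⟩
  · rcases hcons d d' c with e | e | e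
    · rw [e] at h₁; exact absurd h₁ hn
    · rw [e] at h₁; exact absurd h₁ hn'
    · exact e
  · rcases hcons d c d' with e | e | e
    · rw [e] at h₂; exact absurd h₂ hn
    · exact e
    · rw [e] at h₂; exact absurd h₂ hn'
  · rcases hcons c d d' with e | e | e
    · exact e
    · rw [e] at h₃; exact absurd h₃ hn
    · rw [e] at h₃; exact absurd h₃ hn'

/-- A class of a congruence, together with equality elsewhere, is again a congruence. -/
theorem CongOn.restrict_class {C : Set A} {θ : A → A → Prop} (h : CongOn f C θ)
    (hcons : IsConservative f) (hmin : IsMinority f) (e : A) :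
    CongOn f C fun x y => θ x y ∧ (x = y ∨ θ x e) := by
  have tr : ∀ {x y z : A}, (θ x y ∧ (x = y ∨ θ x e)) → (θ y z ∧ (y = z ∨ θ y e)) →
      (θ x z ∧ (x = z ∨ θ x e)) := by
    rintro x y z ⟨h₁, h₁'⟩ ⟨h₂, h₂'⟩
    refine ⟨h.trans h₁ h₂, ?_⟩
    rcases h₁' with rfl | h₁'
    · exact h₂'
    · exact .inr h₁'
  -- Compatibility is checked one argument at a time. If a polynomial sends two members of the class
  -- of `e` to its two different parameters `c` and `d`, then `θ c d`, so the minority law makes `g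
  -- x` congruent to `x`, and the values stay in the class.
  have unary : ∀ (g : A → A), (∀ {x y}, θ x y → θ (g x) (g y)) →
      (∀ c d, (∀ x, g x = x ∨ g x = c ∨ g x = d) →
      (θ c d → ∀ x, x ∈ C → θ (g x) x) →
      ∀ {x y}, (θ x y ∧ (x = y ∨ θ x e)) → (θ (g x) (g y) ∧ (g x = g y ∨ θ (g x) e))) := by
    rintro g hg c d hgc hcd x y ⟨hxy, hxy'⟩
    refine ⟨hg hxy, ?_⟩
    rcases hxy' with rfl | hx
    · exact .inl rfl
    have hy : θ y e := h.trans (h.symm hxy) hx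
    rcases hgc x with e₁ | e₁ | e₁ <;> rcases hgc y with e₂ | e₂ | e₂
    · exact .inr (by rwa [e₁])
    · exact .inr (by rwa [e₁])
    · exact .inr (by rwa [e₁])
    · exact .inr (h.trans (hg hxy) (by rwa [e₂]))
    · exact .inl (e₁.trans e₂.symm)
    · have : θ c d := by have := hg hxy; rwa [e₁, e₂] at this
      exact .inr (h.trans (hcd this x (h.mem hx)) hx)
    · exact .inr (h.trans (hg hxy) (by rwa [e₂]))
    · have : θ c d := by have := hg hxy; rw [e₁, e₂] at this; exact h.symm this
      exact .inr (h.trans (hcd this x (h.mem hx)) hx)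
    · exact .inl (e₁.trans e₂.symm)
  refine ⟨fun h' => h.mem h'.1, fun hx => ⟨h.refl hx, .inl rfl⟩, ?_, tr, ?_⟩
  · rintro x y ⟨h₁, h₂⟩
    refine ⟨h.symm h₁, ?_⟩
    rcases h₂ with rfl | h₂
    · exact .inl rfl
    · exact .inr (h.trans (h.symm h₁) h₂)
  · intro x x' y y' z z' hx hy hz
    have hxC := h.mem hx.1
    have hx'C := h.mem_right hx.1
    have hyC := h.mem hy.1
    have hy'C := h.mem_right hy.1
    have hzC := h.mem hz.1
    refine tr (y := f x' y z) ?_ (tr (y := f x' y' z) ?_ ?_)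
    · refine unary (fun w => f w y z) (fun hw => h.compat hw (h.refl hyC) (h.refl hzC)) y z
        (fun w => hcons w y z) (fun hyz w hw => h.map_right hmin hyz hw) hx
    · refine unary (fun w => f x' w z) (fun hw => h.compat (h.refl hx'C) hw (h.refl hzC)) x' z
        (fun w => ?_) (fun hyz w hw => h.map_middle hmin hyz hw) hy
      have := hcons x' w z
      tauto
    · refine unary (fun w => f x' y' w) (fun hw => h.compat (h.refl hx'C) (h.refl hy'C) hw) x' y'
        (fun w => ?_) (fun hyz w hw => h.map_left hmin hyz hw) hz
      have := hcons x' y' w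
      tauto

/-! ### Subdirect irreducibility -/

/-- In a conservative algebra every subset is a subalgebra. -/
def subalgOf (hcons : IsConservative f) (C : Set A) : Subalg f :=
  ⟨C, fun x hx y hy z hz => by rcases hcons x y z with h | h | h <;> rw [h] <;> assumption⟩

theorem congOn_of_isCongruence {C : Subalg f} {θ : Setoid C.carrier}
    (hθ : IsCongruence C.op θ) :
    CongOn f C.carrier fun a b => ∃ (ha : a ∈ C.carrier) (hb : b ∈ C.carrier),
      θ ⟨a, ha⟩ ⟨b, hb⟩ where
  mem := fun ⟨ha, _⟩ => ha
  refl := fun hx => ⟨hx, hx, θ.refl _⟩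
  symm := fun ⟨ha, hb, h⟩ => ⟨hb, ha, θ.symm h⟩
  trans := fun ⟨ha, _, h⟩ ⟨_, hc, h'⟩ => ⟨ha, hc, θ.trans h h'⟩
  compat := fun ⟨_, _, h₁⟩ ⟨_, _, h₂⟩ ⟨_, _, h₃⟩ => ⟨_, _, hθ _ _ _ _ _ _ h₁ h₂ h₃⟩

/-- If some pair of different elements lies in every nontrivial congruence, then the algebra is
subdirectly irreducible, and the monolith is the intersection of the nontrivial congruences. -/
theorem exists_isMonolith {C : Subalg f} {s t : A} (hs : s ∈ C.carrier) (ht : t ∈ C.carrier)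
    (hst : s ≠ t)
    (h : ∀ θ, CongOn f C.carrier θ → IsNontrivialRel θ → θ s t) :
    ∃ μ : Setoid C.carrier, IsMonolith C.op μ ∧
      ∀ x y : C.carrier, μ x y ↔
        ∀ θ, CongOn f C.carrier θ → IsNontrivialRel θ → θ (x : A) (y : A) := by
  let μ : Setoid C.carrier :=
    { r := fun x y => ∀ θ, CongOn f C.carrier θ → IsNontrivialRel θ → θ (x : A) (y : A)
      iseqv :=
        ⟨fun x θ hθ _ => hθ.refl x.2, fun hxy θ hθ hn => hθ.symm (hxy θ hθ hn),
          fun hxy hyz θ hθ hn => hθ.trans (hxy θ hθ hn) (hyz θ hθ hn)⟩ }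
  have hμ : ∀ x y, μ x y ↔
      ∀ θ, CongOn f C.carrier θ → IsNontrivialRel θ → θ (x : A) (y : A) := fun _ _ => Iff.rfl
  have hcong : IsCongruence C.op μ := fun x x' y y' z z' hx hy hz θ hθ hn =>
    hθ.compat (hx θ hθ hn) (hy θ hθ hn) (hz θ hθ hn)
  have hbot : μ ≠ ⊥ := by
    intro hb
    have : μ ⟨s, hs⟩ ⟨t, ht⟩ := h
    rw [hb] at this
    exact hst (congrArg Subtype.val (show (⟨s, hs⟩ : C.carrier) = ⟨t, ht⟩ from this))
  have hle : ∀ θ : Setoid C.carrier, IsCongruence C.op θ → θ ≠ ⊥ → μ ≤ θ := by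
    intro θ hθ hne x y hxy
    have hn : IsNontrivialRel fun a b => ∃ (ha : a ∈ C.carrier) (hb : b ∈ C.carrier),
        θ ⟨a, ha⟩ ⟨b, hb⟩ := by
      by_contra hcon
      refine hne (le_antisymm (fun a b hab => ?_) bot_le)
      by_contra hab'
      exact hcon ⟨a, b, ⟨a.2, b.2, hab⟩, fun h' => hab' (Subtype.ext h')⟩
    obtain ⟨_, _, h'⟩ := hxy _ (congOn_of_isCongruence hθ) hn
    exact h'
  refine ⟨μ, ⟨⟨hcong, hbot, fun θ hθ hne hle' => le_antisymm hle' (hle θ hθ hne)⟩, ?_⟩, hμ⟩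
  rintro θ ⟨hθ, hne, hmin⟩
  exact (hmin μ hcong hbot (hle θ hθ hne)).symm

theorem IsMonolith.isSubdirectlyIrreducible {X : Type u} {g : X → X → X → X} {μ : Setoid X}
    (h : IsMonolith g μ) : IsSubdirectlyIrreducible g :=
  ⟨μ, h.1, h.2⟩

/-! ### Invariance of the relations of the basis -/

theorem graphOf_closed {B C : Subalg f} {h : B.carrier → C.carrier} (hh : IsHom B.op C.op h) :
    Preserves f (FinRel.ofPairs (graphOf h)).tuples := by
  rintro (r : Fin 2 → A) ⟨a, ha⟩ (s : Fin 2 → A) ⟨b, hb⟩ (t : Fin 2 → A) ⟨c, hc⟩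
  simp only [Prod.mk.injEq] at ha hb hc
  refine ⟨B.op a b c, ?_⟩
  rw [hh]
  change (f (r 0) (s 0) (t 0), f (r 1) (s 1) (t 1)) = _
  rw [ha.1, ha.2, hb.1, hb.2, hc.1, hc.2]
  rfl

/-- With only two labels available, two of the three arguments coincide, so the minority law alone
determines the value. -/
theorem minority_pair {D : Set A} {ℓ : A → ZMod 2} (hmin : IsMinority f)
    (hℓ : Set.InjOn ℓ D) {x y z : A} (hx : x ∈ D) (hy : y ∈ D) (hz : z ∈ D) :
    f x y z ∈ D ∧ ℓ (f x y z) = ℓ x + ℓ y + ℓ z := by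
  have two : ∀ a b c : ZMod 2, (a = b ∨ a = c ∨ b = c) := by decide
  have can : ∀ a b : ZMod 2, a + a + b = b ∧ a + b + a = b ∧ b + a + a = b := by decide
  rcases two (ℓ x) (ℓ y) (ℓ z) with h | h | h
  · obtain rfl := hℓ hx hy h
    rw [(hmin x z).1, (can _ _).1]; exact ⟨hz, rfl⟩
  · obtain rfl := hℓ hx hz h
    rw [(hmin x y).2.1, (can _ _).2.1]; exact ⟨hy, rfl⟩
  · obtain rfl := hℓ hy hz h
    rw [(hmin y x).2.2, (can _ _).2.2]; exact ⟨hx, rfl⟩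

/-- Three tuples in `D` are handled by linearity, as `1 + 1 + 1 = 1`. With two arguments in the
class `D` and one outside, `f` returns the outer one. With one argument in `D`, the resulting unary
polynomial is the identity on `D` or a constant outside `D`. -/
theorem linTuples_closed (hcons : IsConservative f) (hmin : IsMinority f) {C : Subalg f}
    {D : Set A} (hD : IsTwoElementMonolithClass C D) {ℓ : A → ZMod 2} (hℓ : Set.InjOn ℓ D) :
    Preserves f (linTuples C D ℓ) := by
  obtain ⟨μ, hμ, ⟨d₀, hd₀⟩, -⟩ := hD
  have hθ := congOn_of_isCongruence hμ.1.1
  set θ : A → A → Prop := fun a b => ∃ (ha : a ∈ C.carrier) (hb : b ∈ C.carrier),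
      μ ⟨a, ha⟩ ⟨b, hb⟩ with hθdef
  have memD : ∀ {x}, x ∈ D ↔ θ x d₀ := by
    intro x
    rw [hd₀]
    constructor
    · rintro ⟨a, ha, rfl⟩
      exact ⟨a.2, d₀.2, ha⟩
    · rintro ⟨ha, _, h⟩
      exact ⟨⟨x, ha⟩, h, rfl⟩
  have DC : ∀ {x}, x ∈ D → x ∈ C.carrier := fun hx => hθ.mem (memD.1 hx)
  have DD : ∀ {x y}, x ∈ D → y ∈ D → θ x y := fun hx hy =>
    hθ.trans (memD.1 hx) (hθ.symm (memD.1 hy))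
  have Dθ : ∀ {x y}, x ∈ D → θ x y → y ∈ D := fun hx hxy =>
    memD.2 (hθ.trans (hθ.symm hxy) (memD.1 hx))
  have DDN : ∀ {x y c}, x ∈ D → y ∈ D → c ∈ C.carrier \ D →
      f x y c = c ∧ f x c y = c ∧ f c x y = c := fun hx hy hc =>
    hθ.eq_of_not_rel hcons hmin (DD hx hy) hc.1 fun h => hc.2 (Dθ hx h)
  -- a unary polynomial either fixes `D` pointwise or is constant on it, with value outside
  have DNN : ∀ (g : A → A) (c e : A), c ∈ C.carrier \ D → e ∈ C.carrier \ D →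
      (∀ x, g x = x ∨ g x = c ∨ g x = e) → (∀ {x y}, θ x y → θ (g x) (g y)) →
      (θ c e → ∀ x ∈ C.carrier, θ (g x) x) →
      (∀ x ∈ D, g x = x) ∨ (∃ v ∈ C.carrier \ D, ∀ x ∈ D, g x = v) := by
    intro g c e hc he hg hgθ hce
    have hcond : ∀ x ∈ D, ∀ y ∈ D, g x = c → g y = e → c = e := by
      intro x hx y hy h₁ h₂
      have h₃ := hgθ (DD hx hy)
      rw [h₁, h₂] at h₃
      have h₄ := hce h₃ x (DC hx)
      rw [h₁] at h₄
      exact absurd (Dθ hx (hθ.symm h₄)) hc.2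
    have d₀D : (d₀ : A) ∈ D := memD.2 (hθ.refl d₀.2)
    have hout : ∀ x ∈ D, g x ∉ D → ∀ y ∈ D, g y ∉ D :=
      fun x hx hgx y hy hgy => hgx (Dθ hgy (hgθ (DD hy hx)))
    by_cases hgd : g d₀ ∈ D
    · left
      intro x hx
      rcases hg x with h | h | h
      · exact h
      · exact absurd hgd (hout x hx (h ▸ hc.2) _ d₀D)
      · exact absurd hgd (hout x hx (h ▸ he.2) _ d₀D)
    · right
      have hx' : ∀ x ∈ D, g x = c ∨ g x = e := fun x hx =>
        (hg x).resolve_left fun h => hout _ d₀D hgd x hx (h.symm ▸ hx)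
      rcases hx' _ d₀D with h | h
      · refine ⟨c, hc, fun x hx => ?_⟩
        rcases hx' x hx with h' | h'
        · exact h'
        · rw [h', hcond _ d₀D _ hx h h']
      · refine ⟨e, he, fun x hx => ?_⟩
        rcases hx' x hx with h' | h'
        · rw [h', hcond _ hx _ d₀D h' h]
        · exact h'
  have wrap : ∀ (g : A → A) (r : Fin 3 → A), (∀ i, r i ∈ D) → ℓ (r 0) + ℓ (r 1) + ℓ (r 2) = 1 →
      ((∀ x ∈ D, g x = x) ∨ (∃ v ∈ C.carrier \ D, ∀ x ∈ D, g x = v)) →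
      (fun i => g (r i)) ∈ linTuples C D ℓ := by
    rintro g r hr hsum (h | ⟨v, hv, h⟩)
    · have : (fun i => g (r i)) = r := funext fun i => h _ (hr i)
      rw [this]
      exact .inl ⟨hr, hsum⟩
    · exact .inr ⟨v, hv, funext fun i => h _ (hr i)⟩
  rintro r (⟨hr, hr'⟩ | ⟨a, ha, rfl⟩) s (⟨hs, hs'⟩ | ⟨b, hb, rfl⟩) t (⟨ht, ht'⟩ | ⟨c, hc, rfl⟩)
  · left
    refine ⟨fun i => (minority_pair hmin hℓ (hr i) (hs i) (ht i)).1, ?_⟩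
    rw [(minority_pair hmin hℓ (hr 0) (hs 0) (ht 0)).2,
      (minority_pair hmin hℓ (hr 1) (hs 1) (ht 1)).2,
      (minority_pair hmin hℓ (hr 2) (hs 2) (ht 2)).2]
    have : (1 : ZMod 2) + 1 + 1 = 1 := by decide
    linear_combination hr' + hs' + ht' + this
  · exact .inr ⟨c, hc, funext fun i => (DDN (hr i) (hs i) hc).1⟩
  · exact .inr ⟨b, hb, funext fun i => (DDN (hr i) (ht i) hb).2.1⟩
  · exact wrap (fun w => f w b c) r hr hr' (DNN _ b c hb hc (fun w => hcons w b c)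
      (fun h => hθ.compat h (hθ.refl hb.1) (hθ.refl hc.1)) fun h x hx => hθ.map_right hmin h hx)
  · exact .inr ⟨a, ha, funext fun i => (DDN (hs i) (ht i) ha).2.2⟩
  · exact wrap (fun w => f a w c) s hs hs' (DNN _ a c ha hc
      (fun w => by have := hcons a w c; tauto)
      (fun h => hθ.compat (hθ.refl ha.1) h (hθ.refl hc.1)) fun h x hx => hθ.map_middle hmin h hx)
  · exact wrap (fun w => f a b w) t ht ht' (DNN _ a b ha hb
      (fun w => by have := hcons a b w; tauto)
      (fun h => hθ.compat (hθ.refl ha.1) (hθ.refl hb.1) h) fun h x hx => hθ.map_left hmin h hx)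
  · refine .inr ⟨f a b c, ?_, rfl⟩
    rcases hcons a b c with h | h | h <;> rw [h] <;> assumption

theorem basis_closed (hcons : IsConservative f) (hmin : IsMinority f)
    {label : Subalg f → A → ZMod 2} (hlabel : IsLabeling label) :
    ∀ R ∈ basis f label, Preserves f R.tuples := by
  rintro R (((⟨X, rfl⟩ | ⟨B, C, S, -, ⟨-, h, hh, -, rfl, -⟩, -, rfl⟩) |
    ⟨B, C, h, -, -, hh, -, rfl⟩) | ⟨C, D, hC, hD, rfl⟩)
  · exact fun r hr s hs t ht => (subalgOf hcons X).closed _ hr _ hs _ ht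
  · exact graphOf_closed hh
  · exact graphOf_closed hh
  · exact linTuples_closed hcons hmin hD (hlabel C D hC hD).injOn

theorem basis_arity_le (label : Subalg f → A → ZMod 2) :
    ∀ R ∈ basis f label, R.arity ≤ 3 := by
  rintro R (((⟨X, rfl⟩ | ⟨B, C, S, -, -, -, rfl⟩) | ⟨B, C, h, -, -, -, -, rfl⟩) |
    ⟨C, D, -, -, rfl⟩) <;> simp [FinRel.ofPairs]

theorem finite_setOf_arity_le (A : Type u) [Finite A] (m : ℕ) :
    {R : FinRel A | R.arity ≤ m}.Finite := by
  let g : (Σ n : Fin (m + 1), Set (Fin n → A)) → FinRel A := fun p => ⟨p.1, p.2⟩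
  refine (Set.finite_range g).subset fun R hR => ?_
  exact ⟨⟨⟨R.arity, Nat.lt_succ_of_le hR⟩, R.tuples⟩, rfl⟩

end Cong

/-! ### Linkedness congruences and the structure of critical relations -/

section Critical

variable {A : Type u} {f : A → A → A → A} {V : Type}

/-- The projection of a relation to one coordinate. -/
def proj (R : Set (V → A)) (i : V) : Set A := {x | ∃ r ∈ R, r i = x}

/-- `x` and `y` occur at coordinate `i` in two tuples of `R` that agree on `J`. -/
def Linked (R : Set (V → A)) (i : V) (J : Set V) (x y : A) : Prop :=
  ∃ r ∈ R, ∃ r' ∈ R, r i = x ∧ r' i = y ∧ ∀ l ∈ J, r l = r' l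

/-- The Mal'cev exchange: if `q, q'` witness the link, then `f r q q'` moves coordinate `i` from `r
i` to `x` and keeps `r` on `J`. Hence a link, once witnessed anywhere, can be used in every tuple.
-/
theorem Linked.transfer {R : Set (V → A)} (hR : Closed f R) (hmin : IsMinority f) {i : V}
    {J : Set V} {x : A} {r : V → A} (hr : r ∈ R) (h : Linked R i J (r i) x) :
    ∃ r' ∈ R, r' i = x ∧ ∀ l ∈ J, r' l = r l := by
  obtain ⟨q, hq, q', hq', e, rfl, hJ⟩ := h
  refine ⟨_, hR r hr q hq q' hq', ?_, fun l hl => ?_⟩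
  · simp only [e, (hmin _ _).1]
  · simp only [hJ l hl, (hmin _ _).2.2]

theorem congOn_linked {R : Set (V → A)} (hR : Closed f R) (hmin : IsMinority f) (i : V)
    (J : Set V) : CongOn f (proj R i) (Linked R i J) where
  mem := fun ⟨r, hr, _, _, e, _⟩ => ⟨r, hr, e⟩
  refl := fun ⟨r, hr, e⟩ => ⟨r, hr, r, hr, e, e, fun _ _ => rfl⟩
  symm := fun ⟨r, hr, r', hr', e, e', h⟩ => ⟨r', hr', r, hr, e', e, fun l hl => (h l hl).symm⟩
  trans := by
    rintro x y z ⟨r, hr, r', hr', e, rfl, h⟩ hyz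
    obtain ⟨q, hq, rfl, hqJ⟩ := Linked.transfer hR hmin hr' hyz
    exact ⟨r, hr, q, hq, e, rfl, fun l hl => (h l hl).trans (hqJ l hl).symm⟩
  compat := by
    rintro x x' y y' z z' ⟨r, hr, r', hr', rfl, rfl, h₁⟩ ⟨q, hq, q', hq', rfl, rfl, h₂⟩
      ⟨p, hp, p', hp', rfl, rfl, h₃⟩
    exact ⟨_, hR r hr q hq p hp, _, hR r' hr' q' hq' p' hp', rfl, rfl,
      fun l hl => by simp only [h₁ l hl, h₂ l hl, h₃ l hl]⟩

/-- The intersection of the nontrivial congruences of the subalgebra with carrier `C`. -/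
def MonolithRel (f : A → A → A → A) (C : Set A) (x y : A) : Prop :=
  x ∈ C ∧ y ∈ C ∧ ∀ θ, CongOn f C θ → IsNontrivialRel θ → θ x y

theorem congOn_monolithRel (hcons : IsConservative f) (C : Set A) :
    CongOn f C (MonolithRel f C) where
  mem := fun h => h.1
  refl := fun hx => ⟨hx, hx, fun _ hθ _ => hθ.refl hx⟩
  symm := fun h => ⟨h.2.1, h.1, fun θ hθ hn => hθ.symm (h.2.2 θ hθ hn)⟩
  trans := fun h h' => ⟨h.1, h'.2.1, fun θ hθ hn => hθ.trans (h.2.2 θ hθ hn) (h'.2.2 θ hθ hn)⟩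
  compat := fun h h' h'' =>
    ⟨(subalgOf hcons C).closed _ h.1 _ h'.1 _ h''.1,
      (subalgOf hcons C).closed _ h.2.1 _ h'.2.1 _ h''.2.1,
      fun θ hθ hn => hθ.compat (h.2.2 θ hθ hn) (h'.2.2 θ hθ hn) (h''.2.2 θ hθ hn)⟩

/-- A closed relation `R`, maximal in the product of its projections with the property of not
containing `t`, such that each coordinate is determined by the others, and such that changing `t`
at any single coordinate `i` to `s i` leads to a member of `R`. -/
structure Critical [DecidableEq V] (f : A → A → A → A) (R : Set (V → A)) (s t : V → A) :
    Prop where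
  closed : Closed f R
  notMem : t ∉ R
  update_mem : ∀ i, Function.update t i (s i) ∈ R
  functional : ∀ i, ∀ r ∈ R, ∀ r' ∈ R, (∀ j, j ≠ i → r j = r' j) → r i = r' i
  maximal : ∀ Q : Set (V → A), Closed f Q → R ⊆ Q → (∀ x ∈ Q, ∀ i, x i ∈ proj R i) → t ∉ Q →
    Q ⊆ R

namespace Critical

variable [DecidableEq V] {R : Set (V → A)} {s t : V → A}

theorem ne (h : Critical f R s t) (i : V) : s i ≠ t i := by
  intro e
  apply h.notMem
  have := h.update_mem i
  rwa [e, Function.update_eq_self] at this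

theorem fst_mem_proj (h : Critical f R s t) (i : V) : s i ∈ proj R i :=
  ⟨_, h.update_mem i, by simp⟩

theorem snd_mem_proj [Nontrivial V] (h : Critical f R s t) (i : V) : t i ∈ proj R i := by
  obtain ⟨j, hj⟩ := exists_ne i
  exact ⟨_, h.update_mem j, by simp [hj.symm]⟩

/-- Saturate `R` by `θ` at coordinate `i`. If `t` were still missing, maximality would put two
tuples differing only at `i` into `R`, against functionality. So `t` is `θ`-close to a tuple of `R`
agreeing with it off `i`, and functionality makes the value of that tuple at `i` equal to `s i`. -/
theorem rel_of_nontrivial (h : Critical f R s t) {i : V} {θ : A → A → Prop}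
    (hθ : CongOn f (proj R i) θ) (hn : IsNontrivialRel θ) : θ (s i) (t i) := by
  obtain ⟨a, b, hab, hne⟩ := hn
  let Q : Set (V → A) := {x | ∃ y ∈ R, θ (x i) (y i) ∧ ∀ j, j ≠ i → x j = y j}
  have hQ : Closed f Q := by
    rintro x ⟨x', hx', hx, ex⟩ y ⟨y', hy', hy, ey⟩ z ⟨z', hz', hz, ez⟩
    exact ⟨_, h.closed x' hx' y' hy' z' hz', hθ.compat hx hy hz,
      fun j hj => by simp only [ex j hj, ey j hj, ez j hj]⟩
  have hRQ : R ⊆ Q := fun r hr => ⟨r, hr, hθ.refl ⟨r, hr, rfl⟩, fun _ _ => rfl⟩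
  have hQp : ∀ x ∈ Q, ∀ j, x j ∈ proj R j := by
    rintro x ⟨y, hy, hxy, e⟩ j
    by_cases hj : j = i
    · subst hj; exact hθ.mem hxy
    · exact ⟨y, hy, (e j hj).symm⟩
  by_cases ht : t ∈ Q
  · obtain ⟨y, hy, hty, e⟩ := ht
    have := h.functional i y hy _ (h.update_mem i) fun j hj => by simp [hj, e j hj]
    rw [Function.update_self] at this
    rw [this] at hty
    exact hθ.symm hty
  · obtain ⟨r, hr, rfl⟩ := hθ.mem_right hab
    have hmem : Function.update r i a ∈ R := h.maximal Q hQ hRQ hQp ht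
      ⟨r, hr, by simpa using hab, fun j hj => by simp [hj]⟩
    have := h.functional i _ hmem r hr fun j hj => by simp [hj]
    rw [Function.update_self] at this
    exact absurd this hne

theorem exists_monolith [Nontrivial V] (h : Critical f R s t) (hcons : IsConservative f) (i : V) :
    ∃ μ : Setoid (subalgOf hcons (proj R i)).carrier,
      IsMonolith (subalgOf hcons (proj R i)).op μ ∧
      ∀ x y : (subalgOf hcons (proj R i)).carrier, μ x y ↔
        ∀ θ, CongOn f (proj R i) θ → IsNontrivialRel θ → θ (x : A) (y : A) :=
  exists_isMonolith (C := subalgOf hcons (proj R i)) (h.fst_mem_proj i) (h.snd_mem_proj i) (h.ne i)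
    fun _ hθ hn => h.rel_of_nontrivial hθ hn

theorem isSubdirectlyIrreducible [Nontrivial V] (h : Critical f R s t) (hcons : IsConservative f)
    (i : V) : IsSubdirectlyIrreducible (subalgOf hcons (proj R i)).op := by
  obtain ⟨μ, hμ, -⟩ := h.exists_monolith hcons i
  exact hμ.isSubdirectlyIrreducible

/-- The members of the monolith class of `t i` occur in `R` at coordinate `i` next to the values
of `t`, with the exception of any one coordinate `j`. -/
theorem exists_mem_of_monolith (h : Critical f R s t) (hmin : IsMinority f) {i j : V}
    (hij : i ≠ j) {x : A} (hx : ∀ θ, CongOn f (proj R i) θ → IsNontrivialRel θ → θ x (t i)) :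
    ∃ y, Function.update (Function.update t i x) j y ∈ R := by
  have hcong := congOn_linked h.closed hmin i {l | l ≠ i ∧ l ≠ j}
  -- The two one-coordinate changes of `t` show that linkedness off `{i, j}` is a nontrivial
  -- congruence, hence contains the pair `(x, t i)`.
  have hst : Linked R i {l | l ≠ i ∧ l ≠ j} (s i) (t i) :=
    ⟨_, h.update_mem i, _, h.update_mem j, by simp, by simp [hij],
      fun l hl => by simp [hl.1, hl.2]⟩
  have hx' := hcong.symm (hx _ hcong ⟨_, _, hst, h.ne i⟩)
  have hti : Function.update t j (s j) i = t i := by simp [hij]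
  rw [← hti] at hx'
  obtain ⟨r, hr, hri, hrl⟩ := Linked.transfer h.closed hmin (h.update_mem j) hx'
  refine ⟨r j, ?_⟩
  convert hr using 1
  funext l
  by_cases hlj : l = j
  · subst hlj; simp
  by_cases hli : l = i
  · subst hli; simp [hij, hri]
  · rw [hrl l ⟨hli, hlj⟩]; simp [hlj, hli]

/-- The operation maps any arrangement of `x`, `s i` and `t i` to `t i`, if `x` is a third member
of the monolith class. -/
theorem map_eq_of_third (hmin : IsMinority f) (hcons : IsConservative f) (hR : Closed f R)
    (hfun : ∀ i, ∀ r ∈ R, ∀ r' ∈ R, (∀ j, j ≠ i → r j = r' j) → r i = r' i) {i j k : V}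
    (hij : i ≠ j) (hik : i ≠ k) (hjk : j ≠ k) {t : V → A} {a x b c y z : A}
    (h₁ : Function.update t i a ∈ R) (h₂ : Function.update t j b ∈ R)
    (h₃ : Function.update t k c ∈ R) (hy : Function.update (Function.update t i x) j y ∈ R)
    (hz : Function.update (Function.update t i x) k z ∈ R) (ht : t ∉ R) (hxt : x ≠ t i) :
    f x a (t i) = t i := by
  have hc : c ≠ t k := by rintro rfl; rw [Function.update_eq_self] at h₃; exact ht h₃
  -- At `i, j, k` this tuple reads `f x a (t i)`, `y`, `c`, and it equals `t` elsewhere; `hw'` reads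
  -- `f x a x = a`, `y`, `z`. The values `x` and `a` for `f x a (t i)` are both excluded by
  -- functionality.
  have hw := hR _ hy _ h₁ _ h₃
  have hw' := hR _ hy _ h₁ _ hz
  rcases hcons x a (t i) with e | e | e
  · exfalso
    have := hfun k _ hw _ hy fun l hl => by
      by_cases hlj : l = j
      · subst hlj; simp [hij.symm, hjk, (hmin _ _).2.2]
      by_cases hli : l = i
      · subst hli; simp [hij, hik, e]
      · simp [hl, hlj, hli, (hmin _ _).1]
    simp [hik.symm, hjk.symm, (hmin _ _).1] at this
    exact hc this
  · exfalso
    have hzc : z = c := by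
      have := hfun k _ hw' _ hw fun l hl => by
        by_cases hlj : l = j
        · subst hlj; simp [hij.symm, hjk, (hmin _ _).2.2]
        by_cases hli : l = i
        · subst hli; simp [hij, hik, e, (hmin _ _).2.1]
        · simp [hl, hlj, hli, (hmin _ _).1]
      simpa [hik.symm, hjk.symm, (hmin _ _).1] using this
    have := hfun i _ hz _ h₃ fun l hl => by
      by_cases hlk : l = k
      · subst hlk; simp [hzc]
      · simp [hl, hlk]
    simp [hik] at this
    exact hxt this
  · exact e

/-- With at least three coordinates, the monolith class has two elements. -/
theorem eq_or_eq_of_monolith (h : Critical f R s t) (hcons : IsConservative f)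
    (hmin : IsMinority f) {i j k : V} (hij : i ≠ j) (hik : i ≠ k) (hjk : j ≠ k) {x : A}
    (hx : ∀ θ, CongOn f (proj R i) θ → IsNontrivialRel θ → θ x (t i)) : x = s i ∨ x = t i := by
  by_contra! hne
  obtain ⟨hxs, hxt⟩ := hne
  obtain ⟨y, hy⟩ := h.exists_mem_of_monolith hmin hij hx
  obtain ⟨z, hz⟩ := h.exists_mem_of_monolith hmin hik hx
  have e₁ := map_eq_of_third hmin hcons h.closed h.functional hij hik hjk (h.update_mem i)
    (h.update_mem j) (h.update_mem k) hy hz h.notMem hxt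
  have hx' : Function.update t i x ∉ R := by
    intro hmem
    have := h.functional i _ hmem _ (h.update_mem i) fun l hl => by simp [hl]
    rw [Function.update_self, Function.update_self] at this
    exact hxs this
  -- the same for the reversed operation, with the roles of `x` and `t i` exchanged
  have e₂ := map_eq_of_third (f := fun a b c => f c b a) (t := Function.update t i x) (x := t i)
    (y := s j) (z := s k)
    (fun a b => ⟨(hmin a b).2.2, (hmin a b).2.1, (hmin a b).1⟩)
    (fun a b c => by have := hcons c b a; tauto) (fun p hp q hq r hr => h.closed r hr q hq p hp)
    h.functional hij hik hjk (by rw [Function.update_idem]; exact h.update_mem i) hy hz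
    (by rw [Function.update_idem, Function.update_eq_self]; exact h.update_mem j)
    (by rw [Function.update_idem, Function.update_eq_self]; exact h.update_mem k)
    hx' (by simpa using hxt.symm)
  rw [Function.update_self] at e₂
  -- The element `f x (s i) (t i)` would be both `x` and `t i`.
  exact hxt (e₂.symm.trans e₁)

/-- For a pair `d, d'` from the monolith class and `c` outside of it, `f` applied to these elements
in any order gives `c`. -/
theorem map_pair (h : Critical f R s t) (hcons : IsConservative f) (hmin : IsMinority f)
    (h₃ : ∀ i j : V, ∃ k, k ≠ i ∧ k ≠ j) {i : V} {d d' c : A}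
    (hd : d = s i ∨ d = t i) (hd' : d' = s i ∨ d' = t i) (hc : c ∈ proj R i)
    (hn : ¬ (c = s i ∨ c = t i)) : f d d' c = c ∧ f d c d' = c ∧ f c d d' = c := by
  obtain ⟨j, hj, -⟩ := h₃ i i
  obtain ⟨k, hki, hkj⟩ := h₃ i j
  have : Nontrivial V := ⟨i, j, hj.symm⟩
  have hμ := congOn_monolithRel hcons (proj R i)
  have hst : MonolithRel f (proj R i) (s i) (t i) :=
    ⟨h.fst_mem_proj i, h.snd_mem_proj i, fun θ hθ hn => h.rel_of_nontrivial hθ hn⟩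
  have hmem : ∀ {a}, (a = s i ∨ a = t i) → MonolithRel f (proj R i) a (t i) := by
    rintro a (rfl | rfl)
    · exact hst
    · exact hμ.refl (h.snd_mem_proj i)
  refine hμ.eq_of_not_rel hcons hmin (hμ.trans (hmem hd) (hμ.symm (hmem hd'))) hc fun hdc => hn ?_
  exact h.eq_or_eq_of_monolith hcons hmin hj.symm hki.symm hkj.symm
    (hμ.trans (hμ.symm hdc) (hmem hd)).2.2

/-- A tuple of `R` lies in the monolith classes at all coordinates or at none. -/
theorem mem_pair_of_mem_pair (h : Critical f R s t) (hcons : IsConservative f)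
    (hmin : IsMinority f) (h₃ : ∀ i j : V, ∃ k, k ≠ i ∧ k ≠ j) {r : V → A} (hr : r ∈ R) {j : V}
    (hj : r j = s j ∨ r j = t j) (i : V) : r i = s i ∨ r i = t i := by
  by_contra hi
  have hij : i ≠ j := by rintro rfl; exact hi hj
  -- If `r i` is outside its pair, this application of `f` leaves `r` unchanged off `j`, but at `j`
  -- it exchanges `s j` and `t j`.
  have := h.functional j _ (h.closed _ (h.update_mem i) _ (h.update_mem j) _ hr) _ hr
    fun l hl => by
      by_cases hli : l = i
      · subst hli
        simpa [hl] using (h.map_pair hcons hmin h₃ (.inl rfl) (.inr rfl) ⟨r, hr, rfl⟩ hi).1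
      · simp [hl, hli, (hmin _ _).1]
  simp only [Function.update_self, Function.update_of_ne hij.symm] at this
  rcases hj with e | e
  · rw [e, (hmin _ _).2.2] at this
    exact h.ne j this.symm
  · rw [e, (hmin _ _).2.1] at this
    exact h.ne j this

/-- A tuple of `R` outside of the monolith classes is determined by any coordinate. -/
theorem eq_of_not_mem_pair (h : Critical f R s t) (hcons : IsConservative f)
    (hmin : IsMinority f) (h₃ : ∀ i j : V, ∃ k, k ≠ i ∧ k ≠ j) {r r' : V → A} (hr : r ∈ R)
    (hr' : r' ∈ R) {i : V} (hi : ¬ (r i = s i ∨ r i = t i)) (e : r i = r' i) : r = r' := by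
  funext j
  by_contra hne
  have hcong := congOn_linked h.closed hmin j {i}
  have hl : Linked R j {i} (r j) (r' j) := ⟨r, hr, r', hr', rfl, rfl, by simpa using e⟩
  -- Restricting the congruence to the class of `r j` forces `s j` into that class. Transfer then
  -- gives a tuple inside the pair at `j` but outside it at `i`.
  have hst := h.rel_of_nontrivial (hcong.restrict_class hcons hmin (r j))
    ⟨_, _, ⟨hl, .inr (hcong.refl ⟨r, hr, rfl⟩)⟩, hne⟩
  have hs := hst.2.resolve_left (h.ne j)
  obtain ⟨q, hq, hqj, hqi⟩ := Linked.transfer h.closed hmin hr (hcong.symm hs)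
  have := h.mem_pair_of_mem_pair hcons hmin h₃ hq (.inl hqj) i
  rw [hqi i rfl] at this
  exact hi this

/-- A third coordinate absorbs the parity, so the values at two coordinates are independent. -/
theorem exists_mem_pair (h : Critical f R s t) (hmin : IsMinority f)
    (h₃ : ∀ i j : V, ∃ k, k ≠ i ∧ k ≠ j) {i j : V} (hij : i ≠ j) {d d' : A}
    (hd : d = s i ∨ d = t i) (hd' : d' = s j ∨ d' = t j) : ∃ r ∈ R, r i = d ∧ r j = d' := by
  obtain ⟨k, hki, hkj⟩ := h₃ i j
  rcases hd with rfl | rfl <;> rcases hd' with rfl | rfl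
  · refine ⟨_, h.closed _ (h.update_mem i) _ (h.update_mem j) _ (h.update_mem k), ?_, ?_⟩
    · simp [hij, hki.symm, (hmin _ _).2.2]
    · simp [hij.symm, hkj.symm, (hmin _ _).2.1]
  · exact ⟨_, h.update_mem i, by simp, by simp [hij.symm]⟩
  · exact ⟨_, h.update_mem j, by simp [hij], by simp⟩
  · exact ⟨_, h.update_mem k, by simp [hki.symm], by simp [hkj.symm]⟩

/-- Applying `f` to a tuple and the changes of `t` at `a` and at `b` switches both coordinates from
`t` to `s`, so odd sets are reached from singletons two elements at a time. -/
theorem piecewise_mem_of_odd (h : Critical f R s t) (hmin : IsMinority f) (S : Finset V)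
    (hS : Odd S.card) : S.piecewise s t ∈ R := by
  induction hn : S.card using Nat.strong_induction_on generalizing S with
  | _ n ih =>
    subst hn
    obtain ⟨a, ha⟩ : S.Nonempty := Finset.card_pos.1 hS.pos
    by_cases hS' : S.erase a = ∅
    · have : S = {a} := by rw [← Finset.insert_erase ha, hS']; rfl
      subst this
      rw [Finset.piecewise_singleton]
      exact h.update_mem a
    obtain ⟨b, hb⟩ := Finset.nonempty_iff_ne_empty.2 hS'
    have hba : b ≠ a := (Finset.mem_erase.1 hb).1
    have hca := Finset.card_erase_add_one ha
    have hcb := Finset.card_erase_add_one hb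
    have hmem := ih ((S.erase a).erase b).card (by omega) ((S.erase a).erase b)
      (by rw [← hca, ← hcb] at hS; simpa [Nat.odd_add_one] using hS) rfl
    convert h.closed _ hmem _ (h.update_mem a) _ (h.update_mem b) using 1
    funext l
    by_cases hla : l = a
    · subst hla; simp [ha, hba.symm, (hmin _ _).2.1]
    by_cases hlb : l = b
    · subst hlb; simp [Finset.mem_of_mem_erase hb, hba, (hmin _ _).1]
    by_cases hl : l ∈ S <;> simp [hl, hla, hlb, (hmin _ _).2.2, Finset.piecewise]

/-- A nonempty even set cannot occur: removing one element gives an odd set, and the two tuples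
would differ at one coordinate only. -/
theorem piecewise_mem_iff (h : Critical f R s t) (hmin : IsMinority f) (S : Finset V) :
    S.piecewise s t ∈ R ↔ Odd S.card := by
  refine ⟨fun hS => ?_, h.piecewise_mem_of_odd hmin S⟩
  by_contra hodd
  rcases S.eq_empty_or_nonempty with rfl | ⟨a, ha⟩
  · exact h.notMem (by simpa using hS)
  have hca := Finset.card_erase_add_one ha
  have := h.functional a _ hS _ (h.piecewise_mem_of_odd hmin (S.erase a) (by
    rw [← hca] at hodd; simpa [Nat.odd_add_one] using hodd)) fun l hl => by
      simp [Finset.piecewise, hl]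
  simp [Finset.piecewise, ha] at this
  exact h.ne a this

/-! ### The projections of a critical relation are isomorphic -/

/-- The graph of the isomorphism between two projections that is induced by `R` outside of the
monolith classes. -/
def isoGraph (R : Set (V → A)) (s t : V → A) (i j : V) : Set (A × A) :=
  {p | (p.1 = s i ∧ p.2 = s j) ∨ (p.1 = t i ∧ p.2 = t j) ∨
    (¬ (p.1 = s i ∨ p.1 = t i) ∧ ∃ r ∈ R, r i = p.1 ∧ r j = p.2)}

/-- Split by how many of the three pairs lie in the monolith classes. With three, the minority law
suffices; with two, the outer pair is returned; with none, `R` is closed. A single inner pair need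
not be matched by `R` in a canonical way, but some tuple of `R` realizes it, and the result is that
pair or lies outside. -/
theorem isoGraph_closed (h : Critical f R s t) (hcons : IsConservative f) (hmin : IsMinority f)
    (h₃ : ∀ i j : V, ∃ k, k ≠ i ∧ k ≠ j) (i j : V) {p q r : A × A}
    (hp : p ∈ isoGraph R s t i j) (hq : q ∈ isoGraph R s t i j) (hr : r ∈ isoGraph R s t i j) :
    (f p.1 q.1 r.1, f p.2 q.2 r.2) ∈ isoGraph R s t i j := by
  by_cases hij : i = j
  · subst hij
    have diag : ∀ {p}, p ∈ isoGraph R s t i i → p.2 = p.1 := by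
      rintro ⟨a, b⟩ (⟨rfl, rfl⟩ | ⟨rfl, rfl⟩ | ⟨-, r, -, rfl, rfl⟩) <;> rfl
    have hp' := diag hp
    have hq' := diag hq
    have hr' := diag hr
    obtain ⟨a, a'⟩ := p
    obtain ⟨b, b'⟩ := q
    obtain ⟨c, c'⟩ := r
    dsimp only at hp' hq' hr' ⊢
    subst hp' hq' hr'
    rcases hcons a' b' c' with e | e | e <;> rw [e] <;> assumption
  -- the pairs in `isoGraph` inside and outside of the monolith classes
  have cases_on : ∀ {p}, p ∈ isoGraph R s t i j →
      ((p.1 = s i ∨ p.1 = t i) ∧ (p.2 = s j ∨ p.2 = t j)) ∨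
      (¬ (p.1 = s i ∨ p.1 = t i) ∧ ¬ (p.2 = s j ∨ p.2 = t j) ∧
        ∃ r ∈ R, r i = p.1 ∧ r j = p.2) := by
    rintro ⟨a, b⟩ (⟨rfl, rfl⟩ | ⟨rfl, rfl⟩ | ⟨hn, r, hr, rfl, rfl⟩)
    · exact .inl ⟨.inl rfl, .inl rfl⟩
    · exact .inl ⟨.inr rfl, .inr rfl⟩
    · exact .inr ⟨hn, fun hj => hn (h.mem_pair_of_mem_pair hcons hmin h₃ hr hj i), r, hr, rfl, rfl⟩
  have one : ∀ {p : A × A}, p ∈ isoGraph R s t i j → ∀ u ∈ R,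
      (u i = p.1 ∨ ¬ (u i = s i ∨ u i = t i)) → (u j = p.2 ∨ ¬ (u j = s j ∨ u j = t j)) →
      (u i, u j) ∈ isoGraph R s t i j := by
    rintro ⟨a, b⟩ hp u hu (rfl | hi) hj
    · by_cases hui : u i = s i ∨ u i = t i
      · have := h.mem_pair_of_mem_pair hcons hmin h₃ hu hui j
        obtain rfl := hj.resolve_right (not_not.2 this)
        exact hp
      · exact .inr (.inr ⟨hui, u, hu, rfl, rfl⟩)
    · exact .inr (.inr ⟨hi, u, hu, rfl, rfl⟩)
  have sel : ∀ {P : A → Prop} {a b c : A}, P a → P b → P c → P (f a b c) := by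
    intro P a b c ha hb hc
    rcases hcons a b c with e | e | e <;> rw [e] <;> assumption
  rcases cases_on hp with ⟨p₁, p₂⟩ | ⟨p₁, p₂, x, hx, x₁, x₂⟩ <;>
  rcases cases_on hq with ⟨q₁, q₂⟩ | ⟨q₁, q₂, y, hy, y₁, y₂⟩ <;>
  rcases cases_on hr with ⟨r₁, r₂⟩ | ⟨r₁, r₂, z, hz, z₁, z₂⟩
  · have pair : ∀ {p : A × A}, p ∈ isoGraph R s t i j → (p.1 = s i ∨ p.1 = t i) →
        p = (s i, s j) ∨ p = (t i, t j) := by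
      rintro ⟨a, b⟩ (⟨rfl, rfl⟩ | ⟨rfl, rfl⟩ | ⟨hn, -⟩) hp
      · exact .inl rfl
      · exact .inr rfl
      · exact absurd hp hn
    have hs : (s i, s j) ∈ isoGraph R s t i j := .inl ⟨rfl, rfl⟩
    have ht : (t i, t j) ∈ isoGraph R s t i j := .inr (.inl ⟨rfl, rfl⟩)
    rcases pair hp p₁ with rfl | rfl <;> rcases pair hq q₁ with rfl | rfl <;>
    rcases pair hr r₁ with rfl | rfl <;>
    simpa only [(hmin _ _).1, (hmin _ _).2.1, (hmin _ _).2.2]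
  · rw [(h.map_pair hcons hmin h₃ p₁ q₁ ⟨z, hz, z₁⟩ r₁).1,
      (h.map_pair hcons hmin h₃ p₂ q₂ ⟨z, hz, z₂⟩ r₂).1]
    exact hr
  · rw [(h.map_pair hcons hmin h₃ p₁ r₁ ⟨y, hy, y₁⟩ q₁).2.1,
      (h.map_pair hcons hmin h₃ p₂ r₂ ⟨y, hy, y₂⟩ q₂).2.1]
    exact hq
  · obtain ⟨x, hx, x₁, x₂⟩ := h.exists_mem_pair hmin h₃ hij p₁ p₂
    have := one hp _ (h.closed x hx y hy z hz)
    simp only [x₁, x₂, y₁, y₂, z₁, z₂] at this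
    exact this (sel (P := fun w => w = p.1 ∨ ¬ (w = s i ∨ w = t i)) (.inl rfl) (.inr q₁) (.inr r₁))
      (sel (P := fun w => w = p.2 ∨ ¬ (w = s j ∨ w = t j)) (.inl rfl) (.inr q₂) (.inr r₂))
  · rw [(h.map_pair hcons hmin h₃ q₁ r₁ ⟨x, hx, x₁⟩ p₁).2.2,
      (h.map_pair hcons hmin h₃ q₂ r₂ ⟨x, hx, x₂⟩ p₂).2.2]
    exact hp
  · obtain ⟨y, hy, y₁, y₂⟩ := h.exists_mem_pair hmin h₃ hij q₁ q₂
    have := one hq _ (h.closed x hx y hy z hz)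
    simp only [x₁, x₂, y₁, y₂, z₁, z₂] at this
    exact this (sel (P := fun w => w = q.1 ∨ ¬ (w = s i ∨ w = t i)) (.inr p₁) (.inl rfl) (.inr r₁))
      (sel (P := fun w => w = q.2 ∨ ¬ (w = s j ∨ w = t j)) (.inr p₂) (.inl rfl) (.inr r₂))
  · obtain ⟨z, hz, z₁, z₂⟩ := h.exists_mem_pair hmin h₃ hij r₁ r₂
    have := one hr _ (h.closed x hx y hy z hz)
    simp only [x₁, x₂, y₁, y₂, z₁, z₂] at this
    exact this (sel (P := fun w => w = r.1 ∨ ¬ (w = s i ∨ w = t i)) (.inr p₁) (.inr q₁) (.inl rfl))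
      (sel (P := fun w => w = r.2 ∨ ¬ (w = s j ∨ w = t j)) (.inr p₂) (.inr q₂) (.inl rfl))
  · refine .inr (.inr ⟨sel (P := fun w => ¬ (w = s i ∨ w = t i)) p₁ q₁ r₁, _,
      h.closed x hx y hy z hz, ?_, ?_⟩)
    · simp only [x₁, y₁, z₁]
    · simp only [x₂, y₂, z₂]

end Critical

theorem mem_isomorphismRelations (hcons : IsConservative f) {B C : Set A} {G : Set (A × A)}
    (hB : IsSubdirectlyIrreducible (subalgOf hcons B).op)
    (hC : IsSubdirectlyIrreducible (subalgOf hcons C).op)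
    (hG : ∀ {p q r}, p ∈ G → q ∈ G → r ∈ G → (f p.1 q.1 r.1, f p.2 q.2 r.2) ∈ G)
    (hmem : ∀ p ∈ G, p.1 ∈ B ∧ p.2 ∈ C) (hdom : ∀ x ∈ B, ∃ y, (x, y) ∈ G)
    (hcod : ∀ y ∈ C, ∃ x, (x, y) ∈ G) (hfun : ∀ x y y', (x, y) ∈ G → (x, y') ∈ G → y = y')
    (hinj : ∀ x x' y, (x, y) ∈ G → (x', y) ∈ G → x = x') :
    FinRel.ofPairs G ∈ isomorphismRelations f := by
  choose g hg using hdom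
  let h : (subalgOf hcons B).carrier → (subalgOf hcons C).carrier :=
    fun b => ⟨g b b.2, (hmem _ (hg b b.2)).2⟩
  have hh : ∀ b : (subalgOf hcons B).carrier, ((b : A), (h b : A)) ∈ G := fun b => hg b b.2
  refine ⟨subalgOf hcons B, subalgOf hcons C, h, hB, hC, fun x y z => Subtype.ext ?_, ⟨?_, ?_⟩, ?_⟩
  · exact hfun _ _ _ (hh _) (hG (hh x) (hh y) (hh z))
  · intro a b hab
    have := hh b
    rw [← hab] at this
    exact Subtype.ext (hinj _ _ _ (hh a) this)
  · rintro ⟨y, hy⟩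
    obtain ⟨x, hx⟩ := hcod y hy
    exact ⟨⟨x, (hmem _ hx).1⟩, Subtype.ext (hfun _ _ _ (hh _) hx)⟩
  · congr 1
    ext ⟨x, y⟩
    constructor
    · intro hxy
      exact ⟨⟨x, (hmem _ hxy).1⟩, Prod.ext rfl (hfun _ _ _ hxy (hh ⟨x, (hmem _ hxy).1⟩))⟩
    · rintro ⟨b, e⟩
      rw [e]
      exact hh b

namespace Critical

variable [DecidableEq V] {R : Set (V → A)} {s t : V → A}

theorem isoGraph_mem [Nontrivial V] (h : Critical f R s t) (hcons : IsConservative f)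
    (hmin : IsMinority f) (h₃ : ∀ i j : V, ∃ k, k ≠ i ∧ k ≠ j) (i j : V) :
    FinRel.ofPairs (isoGraph R s t i j) ∈ isomorphismRelations f := by
  refine mem_isomorphismRelations hcons (h.isSubdirectlyIrreducible hcons i)
    (h.isSubdirectlyIrreducible hcons j) (h.isoGraph_closed hcons hmin h₃ i j) ?_ ?_ ?_ ?_ ?_
  · rintro ⟨x, y⟩ (⟨rfl, rfl⟩ | ⟨rfl, rfl⟩ | ⟨-, r, hr, rfl, rfl⟩)
    · exact ⟨h.fst_mem_proj i, h.fst_mem_proj j⟩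
    · exact ⟨h.snd_mem_proj i, h.snd_mem_proj j⟩
    · exact ⟨⟨r, hr, rfl⟩, ⟨r, hr, rfl⟩⟩
  · rintro x ⟨r, hr, rfl⟩
    by_cases hs : r i = s i
    · exact ⟨s j, .inl ⟨hs, rfl⟩⟩
    by_cases ht : r i = t i
    · exact ⟨t j, .inr (.inl ⟨ht, rfl⟩)⟩
    · exact ⟨r j, .inr (.inr ⟨by tauto, r, hr, rfl, rfl⟩)⟩
  · rintro x ⟨r, hr, rfl⟩
    by_cases hs : r j = s j
    · exact ⟨s i, .inl ⟨rfl, hs⟩⟩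
    by_cases ht : r j = t j
    · exact ⟨t i, .inr (.inl ⟨rfl, ht⟩)⟩
    · refine ⟨r i, .inr (.inr ⟨fun hi => ?_, r, hr, rfl, rfl⟩)⟩
      have := h.mem_pair_of_mem_pair hcons hmin h₃ hr hi j
      tauto
  · have hi := h.ne i
    rintro x y y' (⟨rfl, rfl⟩ | ⟨rfl, rfl⟩ | ⟨hn, r, hr, rfl, rfl⟩)
      (⟨e, rfl⟩ | ⟨e, rfl⟩ | ⟨hn', r', hr', e, rfl⟩) <;> dsimp only at *
    any_goals tauto
    rw [h.eq_of_not_mem_pair hcons hmin h₃ hr hr' hn e.symm]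
  · have hj := h.ne j
    have out : ∀ r ∈ R, ¬ (r i = s i ∨ r i = t i) → ¬ (r j = s j ∨ r j = t j) := fun r hr hn hj =>
      hn (h.mem_pair_of_mem_pair hcons hmin h₃ hr hj i)
    rintro x x' y (⟨rfl, rfl⟩ | ⟨rfl, rfl⟩ | ⟨hn, r, hr, rfl, rfl⟩)
      (⟨rfl, e⟩ | ⟨rfl, e⟩ | ⟨hn', r', hr', rfl, e⟩) <;> dsimp only at *
    any_goals tauto
    · exact absurd (.inl e) (out r' hr' hn')
    · exact absurd (.inr e) (out r' hr' hn')
    · exact absurd (.inl e) (out r hr hn)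
    · exact absurd (.inr e) (out r hr hn)
    · rw [h.eq_of_not_mem_pair hcons hmin h₃ hr hr' (out r hr hn) e.symm]

end Critical

end Critical

/-! ### Linear equations -/

section Linear

variable {A : Type u} {f : A → A → A → A} {Γ : Set (FinRel A)}

/-- Assignments that are constant on `l` with value in `C \ D`, or map `l` to `D` such that the sum
of the labels is `ε`. -/
def paritySet {V : Type} (C D : Set A) (ℓ : A → ZMod 2) (l : List V) (ε : ZMod 2) :
    Set (V → A) :=
  {x | ((∀ v ∈ l, x v ∈ D) ∧ (l.map fun v => ℓ (x v)).sum = ε) ∨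
    ∃ c ∈ C \ D, ∀ v ∈ l, x v = c}

/-- A long equation is cut into ternary ones: an auxiliary variable with label `1 + ℓ (x v) + ℓ (x
w)` replaces the first two variables, which changes the right-hand side to `ε + 1`. On constant
tuples it takes the common value. -/
theorem ppDef_paritySet {C : Subalg f} {D : Set A} {ℓ : A → ZMod 2}
    (hΓ : unaryRelations A ⊆ Γ) (hlin : (⟨3, linTuples C D ℓ⟩ : FinRel A) ∈ Γ)
    (hℓ : Set.SurjOn ℓ D Set.univ) {V : Type} (l : List V) (hl : l ≠ []) (ε : ZMod 2) :
    PPDef Γ (paritySet C.carrier D ℓ l ε) := by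
  induction hn : l.length generalizing V l ε with
  | zero => exact absurd (List.length_eq_zero_iff.1 hn) hl
  | succ n ih =>
    match l, hl, hn with
    | [v], _, _ =>
      convert PPDef.mem hΓ ({a | a ∈ D ∧ ℓ a = ε} ∪ C.carrier \ D) v using 1
      ext x
      simp [paritySet]
    | v :: w :: l', _, hn =>
      have h₁ := PPDef.rel (V := V ⊕ Unit) hlin ![.inl v, .inl w, .inr ()]
      have h₂ := ih (.inr () :: l'.map Sum.inl : List (V ⊕ Unit)) (by simp) (ε + 1)
        (by simpa using hn)
      convert (h₁.inter h₂).exists using 1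
      have two : (1 : ZMod 2) + 1 = 0 := by decide
      have dbl : ∀ a : ZMod 2, a + a = 0 := by decide
      ext x
      constructor
      · rintro (⟨hD, hsum⟩ | ⟨c, hc, hx⟩)
        · simp only [List.map_cons, List.sum_cons] at hsum
          have hv := hD v (by simp)
          have hw := hD w (by simp)
          obtain ⟨u, hu, hu'⟩ := hℓ (Set.mem_univ (1 + ℓ (x v) + ℓ (x w)))
          refine ⟨fun _ => u, .inl ⟨?_, ?_⟩, .inl ⟨?_, ?_⟩⟩
          · intro i
            fin_cases i
            exacts [hv, hw, hu]
          · change ℓ (x v) + ℓ (x w) + ℓ u = 1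
            rw [hu']
            linear_combination dbl (ℓ (x v)) + dbl (ℓ (x w))
          · intro a ha
            rcases List.mem_cons.1 ha with rfl | ha
            · exact hu
            · obtain ⟨b, hb, rfl⟩ := List.mem_map.1 ha
              exact hD b (by simp [hb])
          · simp only [List.map_cons, List.map_map, List.sum_cons, Function.comp_def,
              Sum.elim_inl, Sum.elim_inr]
            rw [hu']
            linear_combination hsum
        · refine ⟨fun _ => c, .inr ⟨c, hc, ?_⟩, .inr ⟨c, hc, ?_⟩⟩
          · funext i
            fin_cases i
            exacts [hx v (by simp), hx w (by simp), rfl]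
          · intro a ha
            rcases List.mem_cons.1 ha with rfl | ha
            · rfl
            · obtain ⟨b, hb, rfl⟩ := List.mem_map.1 ha
              exact hx b (by simp [hb])
      · rintro ⟨y, hy₁, hy₂⟩
        rcases hy₁ with ⟨hD, hsum⟩ | ⟨c, hc, hx⟩
        · have hv : x v ∈ D := hD 0
          have hw : x w ∈ D := hD 1
          have hu : y () ∈ D := hD 2
          change ℓ (x v) + ℓ (x w) + ℓ (y ()) = 1 at hsum
          rcases hy₂ with ⟨hD', hsum'⟩ | ⟨c, hc, hx'⟩
          · refine .inl ⟨?_, ?_⟩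
            · intro a ha
              rcases List.mem_cons.1 ha with rfl | ha
              · exact hv
              rcases List.mem_cons.1 ha with rfl | ha
              · exact hw
              · exact hD' (.inl a) (by simp [ha])
            · simp only [List.map_cons, List.map_map, List.sum_cons, Function.comp_def,
                Sum.elim_inl, Sum.elim_inr] at hsum' ⊢
              linear_combination hsum + hsum' + two - dbl (ℓ (y ()))
          · exact absurd ((hx' (.inr ()) (by simp)) ▸ hu) hc.2
        · have hv : x v = c := congrFun hx 0
          have hw : x w = c := congrFun hx 1
          have hu : y () = c := congrFun hx 2
          rcases hy₂ with ⟨hD', -⟩ | ⟨c', hc', hx'⟩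
          · exact absurd (hu ▸ hD' (.inr ()) (by simp)) hc.2
          · have : c' = c := (hx' (.inr ()) (by simp)).symm.trans hu
            subst this
            refine .inr ⟨c', hc, ?_⟩
            intro a ha
            rcases List.mem_cons.1 ha with rfl | ha
            · exact hv
            rcases List.mem_cons.1 ha with rfl | ha
            · exact hw
            · exact hx' (.inl a) (by simp [ha])

end Linear

/-! ### Critical relations are definable -/

section Definability

variable {A : Type u} {f : A → A → A → A} {V : Type} {label : Subalg f → A → ZMod 2}

theorem unaryRelations_subset_basis : unaryRelations A ⊆ basis f label :=
  fun _ h => .inl (.inl (.inl h))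

theorem transversalRelations_subset_basis : transversalRelations f ⊆ basis f label :=
  fun _ h => .inl (.inl (.inr h))

theorem isomorphismRelations_subset_basis : isomorphismRelations f ⊆ basis f label :=
  fun _ h => .inl (.inr h)

namespace Critical

variable [DecidableEq V] {R : Set (V → A)} {s t : V → A}

theorem isTwoElementMonolithClass [Nontrivial V] (h : Critical f R s t) (hcons : IsConservative f)
    (hmin : IsMinority f) (h₃ : ∀ i j : V, ∃ k, k ≠ i ∧ k ≠ j) (i : V) :
    IsTwoElementMonolithClass (subalgOf hcons (proj R i)) {s i, t i} := by
  obtain ⟨j, hj, -⟩ := h₃ i i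
  obtain ⟨k, hki, hkj⟩ := h₃ i j
  obtain ⟨μ, hμ, hμ'⟩ := h.exists_monolith hcons i
  refine ⟨μ, hμ, ⟨⟨t i, h.snd_mem_proj i⟩, ?_⟩, Set.ncard_pair (h.ne i)⟩
  ext x
  constructor
  · rintro (rfl | rfl)
    · exact ⟨⟨s i, h.fst_mem_proj i⟩,
        (hμ' _ _).2 fun θ hθ hn => h.rel_of_nontrivial hθ hn, rfl⟩
    · exact ⟨⟨t i, h.snd_mem_proj i⟩, μ.refl _, rfl⟩
  · rintro ⟨x, hx, rfl⟩
    exact h.eq_or_eq_of_monolith hcons hmin hj.symm hki.symm hkj.symm ((hμ' _ _).1 hx)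

/-- Each coordinate is transported to the projection at a fixed `o` by `isoGraph`. There the tuple
either lies in `{s o, t o}` and satisfies one linear equation, or is constant and determined by its
common value. -/
theorem ppDef_of_three [Nontrivial V] [Finite V] (h : Critical f R s t) (hcons : IsConservative f)
    (hmin : IsMinority f) (hlabel : IsLabeling label) (h₃ : ∀ i j : V, ∃ k, k ≠ i ∧ k ≠ j) :
    PPDef (basis f label) R := by
  have := Fintype.ofFinite V
  obtain ⟨o⟩ : Nonempty V := inferInstance
  have hD := h.isTwoElementMonolithClass hcons hmin h₃ o
  have hSI := h.isSubdirectlyIrreducible hcons o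
  have hbij := hlabel _ _ hSI hD
  set C := subalgOf hcons (proj R o)
  set ℓ := label C
  -- Since `ℓ (s o) = ℓ (t o) + 1`, the label sum is `card V * ℓ (t o)` plus the number of
  -- coordinates with value `s i`, which must be odd.
  set ε : ZMod 2 := Fintype.card V * ℓ (t o) + 1
  have hpar := ppDef_paritySet (Γ := basis f label) (V := V) unaryRelations_subset_basis
    (.inr ⟨C, {s o, t o}, hSI, hD, rfl⟩) hbij.surjOn Finset.univ.toList
    (by simpa using Finset.univ_nonempty.ne_empty) ε
  have hiso : PPDef (basis f label)
      {x : V ⊕ V → A | ∀ i, (x (.inr i), x (.inl i)) ∈ isoGraph R s t o i} :=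
    PPDef.forall fun i => PPDef.pair
      (isomorphismRelations_subset_basis (h.isoGraph_mem hcons hmin h₃ o i)) _ _
  have hst : ℓ (s o) = ℓ (t o) + 1 := by
    have hne : ℓ (s o) ≠ ℓ (t o) := fun e => h.ne o (hbij.injOn (by simp) (by simp) e)
    have : ∀ a b : ZMod 2, a ≠ b → a = b + 1 := by decide
    exact this _ _ hne
  -- inside the monolith classes, `R` is determined by the parity
  have hodd : ∀ (x y : V → A),
      (∀ i, (x i = s i ∧ y i = s o) ∨ (x i = t i ∧ y i = t o)) →
      (x ∈ R ↔ ∑ i, ℓ (y i) = ε) := by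
    intro x y hxy
    classical
    have hx : x = (Finset.univ.filter fun i => x i = s i).piecewise s t := by
      funext i
      by_cases hi : x i = s i
      · simp [Finset.piecewise, hi]
      · have := (hxy i).resolve_left fun h => hi h.1
        simp [Finset.piecewise, this.1, (h.ne i).symm]
    have hy : ∀ i, ℓ (y i) = ℓ (t o) + if x i = s i then 1 else 0 := by
      intro i
      rcases hxy i with ⟨e₁, e₂⟩ | ⟨e₁, e₂⟩
      · rw [e₂, if_pos e₁, hst]
      · rw [e₂, if_neg (by rw [e₁]; exact (h.ne i).symm), add_zero]
    have hsum : ∑ i, ℓ (y i) = Fintype.card V * ℓ (t o) +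
        ((Finset.univ.filter fun i => x i = s i).card : ZMod 2) := by
      simp only [hy, Finset.sum_add_distrib, Finset.sum_const, Finset.card_univ, nsmul_eq_mul,
        Finset.sum_boole]
    rw [hsum, hx, h.piecewise_mem_iff hmin, ← hx, add_right_inj]
    rw [ZMod.natCast_eq_one_iff_odd]
  convert (hiso.inter (hpar.comap (Sum.inr : V → V ⊕ V))).exists using 1
  ext x
  constructor
  · intro hx
    by_cases hxo : x o = s o ∨ x o = t o
    · classical
      have hall := h.mem_pair_of_mem_pair hcons hmin h₃ hx hxo
      let y : V → A := fun i => if x i = s i then s o else t o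
      have hxy : ∀ i, (x i = s i ∧ y i = s o) ∨ (x i = t i ∧ y i = t o) := by
        intro i
        by_cases hi : x i = s i
        · exact .inl ⟨hi, if_pos hi⟩
        · exact .inr ⟨(hall i).resolve_left hi, if_neg hi⟩
      refine ⟨y, fun i => ?_, .inl ⟨fun i _ => ?_, ?_⟩⟩
      · rcases hxy i with ⟨e₁, e₂⟩ | ⟨e₁, e₂⟩
        · exact .inl ⟨e₂, e₁⟩
        · exact .inr (.inl ⟨e₂, e₁⟩)
      · rcases hxy i with ⟨e₁, e₂⟩ | ⟨e₁, e₂⟩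
        · exact .inl e₂
        · exact .inr e₂
      · simpa [Finset.sum_map_toList] using (hodd x y hxy).1 hx
    · exact ⟨fun _ => x o, fun i => .inr (.inr ⟨hxo, x, hx, rfl, rfl⟩),
        .inr ⟨x o, ⟨⟨x, hx, rfl⟩, hxo⟩, fun i _ => rfl⟩⟩
  · rintro ⟨y, hy, ⟨hyD, hsum⟩ | ⟨c, hc, hyc⟩⟩
    · refine (hodd x y fun i => ?_).2 (by simpa [Finset.sum_map_toList] using hsum)
      rcases hy i with ⟨e₁, e₂⟩ | ⟨e₁, e₂⟩ | ⟨hn, -⟩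
      · exact .inl ⟨e₂, e₁⟩
      · exact .inr ⟨e₂, e₁⟩
      · exact absurd (hyD i (by simp)) hn
    · obtain ⟨⟨r, hr, hro⟩, hcn⟩ := hc
      have hyc' : ∀ i, y i = c := fun i => hyc i (by simp)
      have : x = r := by
        funext i
        rcases hy i with ⟨e₁, -⟩ | ⟨e₁, -⟩ | ⟨hn, q, hq, e₁, e₂⟩
        · exact absurd (.inl ((hyc' i).symm.trans e₁)) hcn
        · exact absurd (.inr ((hyc' i).symm.trans e₁)) hcn
        · have e₁' : q o = y i := e₁
          have e₂' : q i = x i := e₂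
          rw [← e₂', h.eq_of_not_mem_pair hcons hmin h₃ hr hq (i := o) (by rw [hro]; exact hcn)
            (by rw [hro, e₁', hyc'])]
      rw [this]
      exact hr

theorem ppDef_of_two (h : Critical f R s t) (hcons : IsConservative f) {i j : V} (hij : i ≠ j)
    (htwo : ∀ k, k = i ∨ k = j) : PPDef (basis f label) R := by
  have : Nontrivial V := ⟨i, j, hij⟩
  let G : Set (A × A) := {p | ∃ r ∈ R, r i = p.1 ∧ r j = p.2}
  have ext_of : ∀ {r r' : V → A}, r i = r' i → r j = r' j → r = r' := by
    intro r r' hi hj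
    funext k
    rcases htwo k with rfl | rfl <;> assumption
  have hG : FinRel.ofPairs G ∈ isomorphismRelations f := by
    refine mem_isomorphismRelations hcons (h.isSubdirectlyIrreducible hcons i)
      (h.isSubdirectlyIrreducible hcons j) ?_ ?_ ?_ ?_ ?_ ?_
    · rintro ⟨_, _⟩ ⟨_, _⟩ ⟨_, _⟩ ⟨p, hp, rfl, rfl⟩ ⟨q, hq, rfl, rfl⟩ ⟨r, hr, rfl, rfl⟩
      exact ⟨_, h.closed p hp q hq r hr, rfl, rfl⟩
    · rintro ⟨_, _⟩ ⟨r, hr, rfl, rfl⟩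
      exact ⟨⟨r, hr, rfl⟩, ⟨r, hr, rfl⟩⟩
    · rintro _ ⟨r, hr, rfl⟩
      exact ⟨r j, r, hr, rfl, rfl⟩
    · rintro _ ⟨r, hr, rfl⟩
      exact ⟨r i, r, hr, rfl, rfl⟩
    · rintro _ _ _ ⟨r, hr, rfl, rfl⟩ ⟨r', hr', e, rfl⟩
      refine h.functional j r hr r' hr' fun k hk => ?_
      obtain rfl := (htwo k).resolve_right hk
      exact e.symm
    · rintro _ _ _ ⟨r, hr, rfl, rfl⟩ ⟨r', hr', rfl, e⟩
      refine h.functional i r hr r' hr' fun k hk => ?_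
      obtain rfl := (htwo k).resolve_left hk
      exact e.symm
  convert PPDef.pair (Γ := basis f label) (isomorphismRelations_subset_basis hG) i j using 1
  ext x
  constructor
  · exact fun hx => ⟨x, hx, rfl, rfl⟩
  · rintro ⟨r, hr, hi, hj⟩
    rwa [← ext_of hi hj]

theorem ppDef [Nontrivial V] [Finite V] (h : Critical f R s t) (hcons : IsConservative f)
    (hmin : IsMinority f) (hlabel : IsLabeling label) : PPDef (basis f label) R := by
  by_cases h₃ : ∀ i j : V, ∃ k, k ≠ i ∧ k ≠ j
  · exact h.ppDef_of_three hcons hmin hlabel h₃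
  · push Not at h₃
    obtain ⟨i, j, hij⟩ := h₃
    by_cases e : i = j
    · subst e
      obtain ⟨k, hk⟩ := exists_ne i
      exact absurd (hij k hk) hk
    · exact h.ppDef_of_two hcons e fun k => or_iff_not_imp_left.2 (hij k)

end Critical

/-! ### Reduction to critical relations -/

/-- A maximal closed relation without `t` is definable if all tuples that arise from `t` by a
suitable change of one coordinate belong to it. -/
theorem ppDef_of_maximal [Nontrivial V] [Finite V] [DecidableEq V] (hcons : IsConservative f)
    (hmin : IsMinority f) (hlabel : IsLabeling label) {R : Set (V → A)} (hR : Closed f R)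
    {s t : V → A} (ht : t ∉ R) (hs : ∀ i, Function.update t i (s i) ∈ R)
    (hmax : ∀ Q : Set (V → A), Closed f Q → R ⊆ Q → t ∉ Q → Q ⊆ R) :
    PPDef (basis f label) R := by
  have := Fintype.ofFinite V
  -- the coordinate kernels, and retractions onto transversals of them
  let κ : V → Setoid A := fun i =>
    { r := fun x y => ∀ u : V → A, Function.update u i x ∈ R ↔ Function.update u i y ∈ R
      iseqv := ⟨fun _ _ => Iff.rfl, fun h u => (h u).symm, fun h h' u => (h u).trans (h' u)⟩ }
  let h : V → A → A := fun i x => (Quotient.mk (κ i) x).out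
  have hκ : ∀ i x, κ i (h i x) x := fun i x => Quotient.mk_out (s := κ i) x
  have heq : ∀ {i x y}, κ i x y → h i x = h i y := by
    intro i x y hxy
    exact congrArg Quotient.out (Quotient.sound (s := κ i) hxy)
  have hidem : ∀ i x, h i (h i x) = h i x := fun i x => heq (hκ i x)
  have hmemR : ∀ x : V → A, (fun i => h i (x i)) ∈ R ↔ x ∈ R := by
    intro x
    have key : ∀ S : Finset V, S.piecewise (fun i => h i (x i)) x ∈ R ↔ x ∈ R := by
      intro S
      induction S using Finset.induction_on with
      | empty => simp
      | insert a S ha ih =>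
        rw [Finset.piecewise_insert, hκ a (x a), ← ih]
        have : S.piecewise (fun i => h i (x i)) x a = x a := by simp [ha]
        conv_lhs => rw [← this, Function.update_eq_self]
    simpa using key Finset.univ
  -- By the Mal'cev exchange, two values that share one context in `R` share all of them.
  have hlink : ∀ {i x y}, Linked R i {l | l ≠ i} x y → κ i x y := by
    have half : ∀ {i x y}, Linked R i {l | l ≠ i} x y → ∀ u : V → A,
        Function.update u i x ∈ R → Function.update u i y ∈ R := by
      intro i x y hxy u hu
      obtain ⟨r, hr, hri, hrl⟩ := Linked.transfer hR hmin hu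
        (by rw [Function.update_self]; exact hxy)
      convert hr using 1
      funext l
      by_cases hl : l = i
      · subst hl; simp [hri]
      · rw [hrl l hl]; simp [hl]
    intro i x y hxy u
    exact ⟨half hxy u, half ((congOn_linked hR hmin i _).symm hxy) u⟩
  have hlink' : ∀ {i x}, x ∈ proj R i → Linked R i {l | l ≠ i} x (h i x) := by
    rintro i _ ⟨r, hr, rfl⟩
    refine ⟨r, hr, Function.update r i (h i (r i)), ?_, rfl, by simp, fun l hl => ?_⟩
    · rw [hκ i (r i) r]; simpa using hr
    · have : l ≠ i := hl
      simp [this]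
  have hproj : ∀ {i x}, x ∈ proj R i → h i x ∈ proj R i := fun hx =>
    (congOn_linked hR hmin _ _).mem_right (hlink' hx)
  have hhom : ∀ {i x y z}, x ∈ proj R i → y ∈ proj R i → z ∈ proj R i →
      h i (f x y z) = f (h i x) (h i y) (h i z) := by
    intro i x y z hx hy hz
    have e₁ := heq (hlink ((congOn_linked hR hmin i _).compat (hlink' hx) (hlink' hy) (hlink' hz)))
    rw [e₁]
    -- By conservativity the value on representatives is itself a representative.
    rcases hcons (h i x) (h i y) (h i z) with e | e | e <;> rw [e, hidem]
  let R₀ : Set (V → A) := {x | x ∈ R ∧ ∀ i, h i (x i) = x i}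
  have hR₀ : ∀ {x}, x ∈ R → (fun i => h i (x i)) ∈ R₀ := fun {x} hx =>
    ⟨(hmemR x).2 hx, fun i => hidem i _⟩
  have hproj₀ : ∀ {i x}, x ∈ proj R₀ i → x ∈ proj R i ∧ h i x = x := by
    rintro i _ ⟨r, hr, rfl⟩
    exact ⟨⟨r, hr.1, rfl⟩, hr.2 i⟩
  have hproj₁ : ∀ {i x}, x ∈ proj R i → h i x ∈ proj R₀ i := by
    rintro i _ ⟨r, hr, rfl⟩
    exact ⟨_, hR₀ hr, rfl⟩
  have hcrit : Critical f R₀ (fun i => h i (s i)) (fun i => h i (t i)) := by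
    refine ⟨?_, fun h' => ht ((hmemR t).1 h'.1), fun i => ?_, ?_, ?_⟩
    · intro x hx y hy z hz
      refine ⟨hR x hx.1 y hy.1 z hz.1, fun i => ?_⟩
      rw [hhom ⟨x, hx.1, rfl⟩ ⟨y, hy.1, rfl⟩ ⟨z, hz.1, rfl⟩, hx.2, hy.2, hz.2]
    · convert hR₀ (hs i) using 1
      funext l
      by_cases hl : l = i
      · subst hl; simp
      · simp [hl]
    · intro i r hr r' hr' e
      rw [← hr.2 i, ← hr'.2 i]
      exact heq (hlink ⟨r, hr.1, r', hr'.1, rfl, rfl, e⟩)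
    · intro Q hQ hRQ hQp htQ x hx
      have hx' : x ∈ R := by
        -- Maximality descends to `R₀` by pulling `Q` back along the retractions; the projections
        -- are kept because the retractions are homomorphisms only there.
        refine hmax {x | (∀ i, x i ∈ proj R i) ∧ (fun i => h i (x i)) ∈ Q} ?_ ?_
          (fun h' => htQ h'.2) ⟨fun i => (hproj₀ (hQp x hx i)).1, ?_⟩
        · rintro x ⟨hx, hx'⟩ y ⟨hy, hy'⟩ z ⟨hz, hz'⟩
          refine ⟨fun i => (subalgOf hcons (proj R i)).closed _ (hx i) _ (hy i) _ (hz i), ?_⟩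
          convert hQ _ hx' _ hy' _ hz' using 1
          funext i
          exact hhom (hx i) (hy i) (hz i)
        · exact fun r hr => ⟨fun i => ⟨r, hr, rfl⟩, hRQ (hR₀ hr)⟩
        · convert hx using 1
          funext i
          exact (hproj₀ (hQp x hx i)).2
      exact ⟨hx', fun i => (hproj₀ (hQp x hx i)).2⟩
  let S : V → Set (A × A) := fun i => {p | p.1 ∈ proj R i ∧ p.2 = h i p.1}
  have hS : ∀ i, FinRel.ofPairs (S i) ∈ transversalRelations f := by
    intro i
    let g : (subalgOf hcons (proj R i)).carrier → (subalgOf hcons (proj R₀ i)).carrier :=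
      fun x => ⟨h i x, hproj₁ x.2⟩
    refine ⟨subalgOf hcons (proj R i), subalgOf hcons (proj R₀ i), S i,
      hcrit.isSubdirectlyIrreducible hcons i, ⟨fun x hx => (hproj₀ hx).1, g, ?_, ?_, ?_, ?_⟩,
      ⟨?_, ?_⟩, rfl⟩
    · exact fun x y z => Subtype.ext (hhom x.2 y.2 z.2)
    · exact fun y => ⟨⟨y, (hproj₀ y.2).1⟩, Subtype.ext (hproj₀ y.2).2⟩
    · ext ⟨x, y⟩
      constructor
      · rintro ⟨hx, hy⟩
        exact ⟨⟨x, hx⟩, Prod.ext rfl hy⟩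
      · rintro ⟨b, e⟩
        rw [e]
        exact ⟨b.2, rfl⟩
    · rintro ⟨x, y⟩ ⟨hx, hy⟩
      obtain rfl : y = h i x := hy
      exact ⟨h i x, ⟨hx, rfl⟩, hproj hx, (hidem i x).symm⟩
    · ext x
      constructor
      · rintro ⟨p, hp, rfl⟩
        exact hp.1
      · exact fun hx => ⟨(x, h i x), ⟨hx, rfl⟩, rfl⟩
    · ext y
      constructor
      · rintro ⟨p, ⟨hx, hy⟩, rfl⟩
        rw [hy]
        exact hproj₁ hx
      · exact fun hy => ⟨(y, y), ⟨(hproj₀ hy).1, (hproj₀ hy).2.symm⟩, rfl⟩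
  have hdef : PPDef (basis f label) {x : V ⊕ V → A | ∀ i, (x (.inl i), x (.inr i)) ∈ S i} :=
    PPDef.forall fun i => PPDef.pair (transversalRelations_subset_basis (hS i)) _ _
  convert (hdef.inter ((hcrit.ppDef hcons hmin hlabel).comap (Sum.inr : V → V ⊕ V))).exists using 1
  ext x
  constructor
  · exact fun hx => ⟨fun i => h i (x i), fun i => ⟨⟨x, hx, rfl⟩, rfl⟩, hR₀ hx⟩
  · rintro ⟨y, hy, hyR⟩
    have : y = fun i => h i (x i) := funext fun i => (hy i).2
    rw [← hmemR, ← this]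
    exact hyR.1

/-- A tuple outside of a closed relation can be separated from it by a definable relation. -/
theorem exists_ppDef_separating [Finite A] [Finite V] (hcons : IsConservative f)
    (hmin : IsMinority f) (hlabel : IsLabeling label) {R : Set (V → A)} (hR : Closed f R)
    {t : V → A} (ht : t ∉ R) : ∃ Q : Set (V → A), PPDef (basis f label) Q ∧ R ⊆ Q ∧ t ∉ Q := by
  classical
  have := Fintype.ofFinite V
  -- a minimal set of coordinates on which no member of `R` agrees with `t`
  obtain ⟨I, hI⟩ : ∃ I : Finset V, Minimal (fun I => ∀ r ∈ R, ∃ i ∈ I, r i ≠ t i) I := by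
    refine exists_minimal_of_wellFoundedLT _ ⟨Finset.univ, fun r hr => ?_⟩
    by_contra! hcon
    exact ht ((funext fun i => hcon i (Finset.mem_univ i) : r = t) ▸ hr)
  let σ : I → V := Subtype.val
  suffices ∃ Q : Set (I → A), PPDef (basis f label) Q ∧ (∀ r ∈ R, (fun i => r (σ i)) ∈ Q) ∧
      (fun i => t (σ i)) ∉ Q by
    obtain ⟨Q, hQ, hRQ, htQ⟩ := this
    exact ⟨_, hQ.comap σ, hRQ, htQ⟩
  let R' : Set (I → A) := {x | ∃ r ∈ R, x = fun i => r (σ i)}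
  have ht' : (fun i => t (σ i)) ∉ R' := by
    rintro ⟨r, hr, e⟩
    obtain ⟨i, hi, hne⟩ := hI.prop r hr
    exact hne (congrFun e ⟨i, hi⟩).symm
  have hs : ∀ i : I, ∃ a, Function.update (fun i => t (σ i)) i a ∈ R' := by
    intro i
    -- By minimality of `I`, some member of `R` agrees with `t` on `I` except at `i`; its value
    -- there serves as `s i`.
    have hlt : ¬ ∀ r ∈ R, ∃ j ∈ I.erase i, r j ≠ t j := fun hcon =>
      absurd (hI.le_of_le hcon (Finset.erase_subset _ _) i.2) (by simp)
    push Not at hlt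
    obtain ⟨r, hr, hrt⟩ := hlt
    refine ⟨r i, r, hr, funext fun j => ?_⟩
    by_cases hj : j = i
    · subst hj; simp [σ]
    · rw [Function.update_of_ne hj]
      exact (hrt j (Finset.mem_erase.2 ⟨fun e => hj (Subtype.ext e), j.2⟩)).symm
  choose s hs using hs
  rcases subsingleton_or_nontrivial I with hsub | hnon
  · rcases isEmpty_or_nonempty I with hemp | ⟨⟨o⟩⟩
    · refine ⟨∅, PPDef.empty unaryRelations_subset_basis, fun r hr => ?_, fun h => h⟩
      obtain ⟨i, hi, -⟩ := hI.prop r hr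
      exact hemp.elim ⟨i, hi⟩
    · refine ⟨_, PPDef.mem unaryRelations_subset_basis {a | a ≠ t (σ o)} o, fun r hr => ?_,
        fun h => h rfl⟩
      obtain ⟨i, hi, hne⟩ := hI.prop r hr
      obtain rfl : o = ⟨i, hi⟩ := Subsingleton.elim _ _
      exact hne
  obtain ⟨Q, hRQ, hQ⟩ := Set.Finite.exists_le_maximal
    (Set.toFinite {Q : Set (I → A) | Closed f Q ∧ (fun i => t (σ i)) ∉ Q})
    (show R' ∈ _ from ⟨hR.restrict σ, ht'⟩)
  refine ⟨Q, ?_, fun r hr => hRQ ⟨r, hr, rfl⟩, hQ.prop.2⟩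
  exact ppDef_of_maximal hcons hmin hlabel hQ.prop.1 hQ.prop.2 (fun i => hRQ (hs i))
    fun Q' hQ' hle htQ' => hQ.le_of_ge ⟨hQ', htQ'⟩ hle

theorem ppDef_of_closed [Finite A] [Finite V] (hcons : IsConservative f)
    (hmin : IsMinority f) (hlabel : IsLabeling label) {R : Set (V → A)} (hR : Closed f R) :
    PPDef (basis f label) R := by
  choose Q hQ hRQ htQ using fun t : {t // t ∉ R} =>
    exists_ppDef_separating hcons hmin hlabel hR t.2
  convert PPDef.forall hQ using 1
  ext x
  refine ⟨fun hx t => hRQ t hx, fun hx => ?_⟩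
  by_contra hxR
  exact htQ ⟨x, hxR⟩ (hx ⟨x, hxR⟩)

end Definability

end ConsMinority

theorem mainTheorem5 {A : Type*} [Finite A] (f : A → A → A → A)
    (hcons : ConsMinority.IsConservative f) (hmin : ConsMinority.IsMinority f)
    (label : ConsMinority.Subalg f → A → ZMod 2) (hlabel : ConsMinority.IsLabeling label) :
    (ConsMinority.basis f label).Finite ∧
    (∀ R ∈ ConsMinority.basis f label, R.arity ≤ 3) ∧
    ∀ (k : ℕ) (R : Set (Fin k → A)),
      ConsMinority.Preserves f R ↔ ConsMinority.PPDefinable (ConsMinority.basis f label) R :=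
  ⟨(ConsMinority.finite_setOf_arity_le A 3).subset (ConsMinority.basis_arity_le label),
    ConsMinority.basis_arity_le label, fun _ _ =>
    ⟨fun hR => (ConsMinority.ppDef_of_closed hcons hmin hlabel hR).ppDefinable,
      ConsMinority.preserves_of_ppDefinable (ConsMinority.basis_closed hcons hmin hlabel)⟩⟩
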